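/- Setting. Let $q$ be a prime power, $A=\mathbb{F}_q[t]$, let $K$ be a field extension of $\mathbb{F}_q$ and $i:A\to K$ an injective $\mathbb{F}_q$-algebra morphism. Let $\phi:A\to K\{\tau\}$ ($\tau(x)=x^q$) be a Drinfeld module of generic characteristic: a ring morphism such that $\phi_a$ has constant coefficient $i(a)$ for all $a$, and $\phi_a\neq i(a)\tau^0$ for some $a$. Fix a (real-valued, nonarchimedean) extension $v_\infty$ to $K$ of the valuation $-\deg$ of $\mathbb{F}_q(t)$; let $K_\infty$ be the completion of $K$, $K_\infty^{\rm alg}$ an algebraic closure of it, $\mathbb{C}_\infty$ the completion of $K_\infty^{\rm alg}$, and $K^{\rm sep}\subset K^{\rm alg}\subset K_\infty^{\rm alg}$ the separable and algebraic closures of $K$. Assume $\mathrm{End}(\phi)=A$, i.e. every $f\in K^{\rm sep}\{\tau\}$ with $f\phi_a=\phi_af$ for all $a\in A$ equals some $\phi_b$, $b \in A$. Heights. Fix a family of nontrivial nonarchimedean absolute values $|\cdot|_v$ on $K$ such that each $x\in K^*$ has $|x|_v=1$ for all but finitely many $v$ and $\prod_v|x|_v=1$. For $x\in K^{\rm sep}$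 let $h(x)$ be the sum over $v$ of the average of $\log^+|y|_v$ over the conjugates $y$ of $x$ in an algebraic closure of the completion $K_v$, and let $\hat h(x)=\lim_n h(\phi_{t^n}(x))/(\deg\phi_t)^n$, where $\deg \phi_t$ is the degree of $\phi_t$ as a polynomial in $x$. For $x=(x_1,\dots,x_g)$ put $\hat h(x)=\sum_j\hat h(x_j)$. Definitions. Let $\phi$ act diagonally on $\mathbb{G}_a^g$. Subvarieties are Zariski closed. A point $x\in\mathbb{G}_a^g(K^{\rm alg})$ is torsion if $\phi_a(x)=0$ for some $a\neq0$. An algebraic $\phi$-submodule of $\mathbb{G}_a^g$ is a $K^{\rm sep}$-subvariety that is a subgroup invariant under the action of $\phi$. A torsion subvariety is a translate of an irreducible algebraic $\phi$-submodule by a torsion point. A maximal torsion subvariety of $X$ is a maximal element, for inclusion, among the torsion subvarieties contained in $X$. A sequence in $\mathbb{G}_a^g(K^{\rm alg})$ is strict if every proper torsion subvariety of $\mathbb{G}_a^g$ contains $x_k$ for only finitely many $k$. For $x\in\mathbb{G}_a^g(K^{\rm sep})$ let $\bar\delta_x$ be the uniform probability measure on $\mathbb{C}_\infty^g$ on the (finite)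 orbit of $x$ under $\mathrm{Gal}(K^{\rm sep}/K)$. Let $T\subset\mathbb{C}_\infty$ be the closure of the set of torsion points of $\mathbb{G}_a$ (a compact group), $\nu$ its normalized Haar measure, and $\nu^{(g)}$ the product measure on $T^g\subset\mathbb{C}_\infty^g$. Theorem. Let $N\ge 0$. Assume that for every $1\le g\le N$ the following holds: for every strict sequence $\{x_k\}\subset\mathbb{G}_a^g(K^{\rm sep})$ with $\lim_k\hat h(x_k)=0$, the measures $\bar\delta_{x_k}$ converge weakly to $\nu^{(g)}$. (1) Let $Y$ be an algebraic $\phi$-submodule of $\mathbb{G}_a^N$, let $X$ be a $K^{\rm sep}$-subvariety of $Y$, and let $Z$ be the union of the maximal torsion subvarieties of $X$. Then these are finitely many, and if $Z\neq X$, there is a constant $C>0$ (depending on $X$) such that $\hat h(x)\ge C$ for every $x\in(X\setminus Z)(K^{\rm sep})$. (2) (Bogomolov statement) Let $X$ be an irreducible $K^{\rm sep}$-subvariety of $\mathbb{G}_a^N$ such that for every integer $n\ge1$ the set $\{x\in X(K^{\rm sep}) : \hat h(x)<1/n\}$ is Zariski dense in $X$. Then $X$ is a torsion subvariety. -/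

import Mathlib

open Polynomial Filter Topology

namespace DrinfeldBogomolov

noncomputable section

/-! ### Drinfeld modules -/

/-- `f` is a polynomial in `τ : x ↦ x ^ q`.  The ring `L{τ}` is identified with the set of
polynomials `∑ cₘ X ^ (q ^ m)`, with the usual addition and with composition as product; the
coefficient of `τ ^ m` is the coefficient of `X ^ (q ^ m)`. -/
def IsTauPolynomial (q : ℕ) {L : Type*} [Semiring L] (f : L[X]) : Prop :=
  ∀ n, f.coeff n ≠ 0 → ∃ m, n = q ^ m

/-- A Drinfeld module over `K`: a ring morphism `φ : A = 𝔽_q[t] → K{τ}` such that the coefficient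
of `τ ^ 0` in `φ_a` is `i a` for all `a`, and `φ_a ≠ i(a) τ ^ 0` for some `a`. -/
structure DrinfeldModule {Fq : Type*} [Field Fq] [Fintype Fq] {K : Type*} [Field K] [Algebra Fq K]
    (i : Fq[X] →ₐ[Fq] K) where
  toFun : Fq[X] → K[X]
  isTau : ∀ a, IsTauPolynomial (Fintype.card Fq) (toFun a)
  map_one : toFun 1 = X
  map_add : ∀ a b, toFun (a + b) = toFun a + toFun b
  map_mul : ∀ a b, toFun (a * b) = (toFun a).comp (toFun b)
  coeff_one : ∀ a, (toFun a).coeff 1 = i a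
  nontrivial : ∃ a, toFun a ≠ C (i a) * X

section Generic

variable {Fq : Type*} [Field Fq] [Fintype Fq] {K : Type*} [Field K] [Algebra Fq K]
  {i : Fq[X] →ₐ[Fq] K}

namespace DrinfeldModule

/-- The action `a * x = φ_a(x)` on `𝔾_a(L)`. -/
def act (φ : DrinfeldModule i) {L : Type*} [Field L] [Algebra K L] (a : Fq[X]) (x : L) : L :=
  aeval x (φ.toFun a)

variable (φ : DrinfeldModule i) {L : Type*} [Field L] [Algebra K L]

theorem act_mul (a b : Fq[X]) (x : L) : φ.act (a * b) x = φ.act a (φ.act b x) := by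
  simp [act, φ.map_mul, aeval_comp]

theorem act_one (x : L) : φ.act 1 x = x := by
  simp [act, φ.map_one]

theorem act_add (a : Fq[X]) (x y : L) : φ.act a (x + y) = φ.act a x + φ.act a y := by
  let _ : Algebra Fq L := ((algebraMap K L).comp (algebraMap Fq K)).toAlgebra
  have hq : ∀ m : ℕ, (x + y) ^ Fintype.card Fq ^ m
      = x ^ Fintype.card Fq ^ m + y ^ Fintype.card Fq ^ m := by
    intro m
    induction m with
    | zero => simp
    | succ m ih =>
      rw [pow_succ, pow_mul, ih, pow_mul, pow_mul]
      have := _root_.map_add (FiniteField.frobeniusAlgHom Fq L) (x ^ Fintype.card Fq ^ m)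
        (y ^ Fintype.card Fq ^ m)
      simpa only [FiniteField.coe_frobeniusAlgHom] using this
  simp only [act, aeval_eq_sum_range, ← Finset.sum_add_distrib]
  refine Finset.sum_congr rfl fun n _ => ?_
  by_cases h : (φ.toFun a).coeff n = 0
  · simp [h]
  · obtain ⟨m, rfl⟩ := φ.isTau a n h
    rw [hq, smul_add]

/-- `φ_a` as an additive endomorphism of `𝔾_a(L)`. -/
def actHom (a : Fq[X]) : L →+ L := AddMonoidHom.mk' (φ.act a) (φ.act_add a)

@[simp] theorem actHom_apply (a : Fq[X]) (x : L) : φ.actHom a x = φ.act a x := rfl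

theorem act_zero (a : Fq[X]) : φ.act a (0 : L) = 0 := _root_.map_zero (φ.actHom (L := L) a)

/-- The torsion submodule `φ_tor(L)`: all `x` with `φ_a(x) = 0` for some nonzero `a`. -/
def torsion (φ : DrinfeldModule i) (L : Type*) [Field L] [Algebra K L] : AddSubgroup L where
  carrier := {x | ∃ a : Fq[X], a ≠ 0 ∧ φ.act a x = 0}
  zero_mem' := ⟨1, one_ne_zero, φ.act_zero 1⟩
  add_mem' := by
    rintro x y ⟨a, ha, hx⟩ ⟨b, hb, hy⟩
    refine ⟨a * b, mul_ne_zero ha hb, ?_⟩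
    rw [act_add, act_mul φ a b y, hy, mul_comm, act_mul, hx, act_zero, act_zero, add_zero]
  neg_mem' := by
    rintro x ⟨a, ha, hx⟩
    refine ⟨a, ha, ?_⟩
    rw [← actHom_apply, map_neg, actHom_apply, hx, neg_zero]

/-- Every endomorphism of `φ` with coefficients in `L` (i.e. every `f ∈ L{τ}` with
`f φ_a = φ_a f` for all `a`) is one of the `φ_b`. Taken with `L = K^sep`, this is `End(φ) = A`. -/
def EndEqA (φ : DrinfeldModule i) (L : Type*) [Field L] [Algebra K L] : Prop :=
  ∀ f : L[X], IsTauPolynomial (Fintype.card Fq) f →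
    (∀ a, f.comp ((φ.toFun a).map (algebraMap K L))
      = ((φ.toFun a).map (algebraMap K L)).comp f) →
    ∃ b, f = (φ.toFun b).map (algebraMap K L)

end DrinfeldModule

/-! ### Total boundedness of the torsion

This is what makes the closure of the torsion submodule in `ℂ_∞` compact, so that it carries a
normalized Haar measure. -/

namespace DrinfeldModule

section TotallyBounded

variable (φ : DrinfeldModule i) {L : Type*} [NormedField L] [IsUltrametricDist L] [IsAlgClosed L]
  [Algebra K L]

theorem act_eq_eval {L : Type*} [Field L] [Algebra K L] (a : Fq[X]) (x : L) :
    φ.act a x = ((φ.toFun a).map (algebraMap K L)).eval x := by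
  rw [act, eval_map_algebraMap]

theorem finite_ker {L : Type*} [Field L] [Algebra K L] (hi : Function.Injective i) (a : Fq[X])
    (ha : a ≠ 0) : {x : L | φ.act a x = 0}.Finite := by
  have h0 : (φ.toFun a).map (algebraMap K L) ≠ 0 := by
    intro h
    have h1 := congrArg (fun f => f.coeff 1) h
    simp only [coeff_map, φ.coeff_one, coeff_zero, map_eq_zero] at h1
    exact ha (hi (by rw [h1, map_zero]))
  classical
  refine (((φ.toFun a).map (algebraMap K L)).roots.toFinset.finite_toSet).subset fun x hx => ?_
  simp only [Finset.mem_coe, Multiset.mem_toFinset, mem_roots h0, IsRoot.def]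
  rw [← act_eq_eval]
  exact hx

theorem act_surjective {L : Type*} [Field L] [IsAlgClosed L] [Algebra K L]
    (hi : Function.Injective i) (a : Fq[X]) (ha : a ≠ 0) (y : L) : ∃ x : L, φ.act a x = y := by
  have hd : ((φ.toFun a).map (algebraMap K L) - C y).degree ≠ 0 := by
    intro h
    have h1 : ((φ.toFun a).map (algebraMap K L) - C y).coeff 1 = 0 :=
      coeff_eq_zero_of_degree_lt (by rw [h]; exact_mod_cast Nat.zero_lt_one)
    simp only [coeff_sub, coeff_map, φ.coeff_one, coeff_C_succ, sub_zero, map_eq_zero] at h1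
    exact ha (hi (by rw [h1, map_zero]))
  obtain ⟨x, hx⟩ := IsAlgClosed.exists_root _ hd
  refine ⟨x, ?_⟩
  rw [act_eq_eval]
  simpa [IsRoot.def, sub_eq_zero] using hx

theorem act_sub {L : Type*} [Field L] [Algebra K L] (a : Fq[X]) (x y : L) :
    φ.act a (x - y) = φ.act a x - φ.act a y := map_sub (φ.actHom (L := L) a) x y

/-- If `0` is a root of `φ_a` closest to `x`, then `|φ_a(x)| ≥ |i(a)| |x|`. -/
theorem norm_act_ge (a : Fq[X]) (x : L)
    (hx : ∀ κ : L, φ.act a κ = 0 → ‖x‖ ≤ ‖x - κ‖) :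
    ‖algebraMap K L (i a)‖ * ‖x‖ ≤ ‖φ.act a x‖ := by
  set P := (φ.toFun a).map (algebraMap K L) with hP
  have hP0 : P.coeff 0 = 0 := by
    have := φ.act_zero (L := L) a
    rw [act_eq_eval, ← hP] at this
    rwa [coeff_zero_eq_eval_zero]
  have hPQ : P.divX * X = P := by
    have := divX_mul_X_add P
    rwa [hP0, C_0, add_zero] at this
  have hQ0 : P.divX.eval 0 = algebraMap K L (i a) := by
    rw [← coeff_zero_eq_eval_zero, coeff_divX, hP, coeff_map, zero_add, φ.coeff_one]
  have hev : ∀ z, φ.act a z = P.divX.eval z * z := by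
    intro z
    rw [act_eq_eval, ← hP]
    nth_rewrite 1 [← hPQ]
    rw [eval_mul, eval_X]
  rw [hev x, norm_mul, ← hQ0]
  refine mul_le_mul_of_nonneg_right ?_ (norm_nonneg _)
  rw [(IsAlgClosed.splits P.divX).eval_eq_prod_roots, (IsAlgClosed.splits P.divX).eval_eq_prod_roots,
    norm_mul, norm_mul]
  refine mul_le_mul_of_nonneg_left ?_ (norm_nonneg _)
  have hn : ∀ s : Multiset L, ‖s.prod‖ = (s.map norm).prod := fun s =>
    map_multiset_prod (normHom : L →*₀ ℝ) s
  rw [hn, hn, Multiset.map_map, Multiset.map_map]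
  refine Multiset.prod_map_le_prod_map₀ _ _ (fun _ _ => norm_nonneg _) fun κ hκ => ?_
  have hκ0 : φ.act a κ = 0 := by
    rw [hev, (mem_roots'.1 hκ).2.eq_zero, zero_mul]
  have h1 := hx κ hκ0
  simp only [Function.comp_apply, zero_sub, norm_neg]
  calc ‖κ‖ = ‖x - (x - κ)‖ := by rw [sub_sub_cancel]
    _ ≤ max ‖x‖ ‖x - κ‖ := by
      have := IsUltrametricDist.norm_add_le_max x (-(x - κ))
      rwa [norm_neg, ← sub_eq_add_neg] at this
    _ ≤ ‖x - κ‖ := max_le h1 le_rfl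

theorem exists_ker_near (hi : Function.Injective i) (y : L) :
    ∃ κ : L, φ.act X κ = 0 ∧ ‖algebraMap K L (i X)‖ * ‖y - κ‖ ≤ ‖φ.act X y‖ := by
  obtain ⟨κ, hκ, hmin⟩ := Set.exists_min_image {x : L | φ.act X x = 0} (fun κ => ‖y - κ‖)
    (φ.finite_ker hi X X_ne_zero) ⟨0, φ.act_zero X⟩
  have hκ0 : φ.act X κ = 0 := hκ
  refine ⟨κ, hκ0, ?_⟩
  have := φ.norm_act_ge X (y - κ) fun κ' hκ' => by
    rw [sub_sub]
    exact hmin _ (by simp only [Set.mem_ofPred_eq]; rw [act_add, hκ0, hκ', add_zero])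
  rwa [act_sub, hκ0, sub_zero] at this

theorem exists_ker_pow_near (hi : Function.Injective i) (n : ℕ) (y : L) :
    ∃ κ : L, φ.act (X ^ n) κ = 0 ∧
      ‖algebraMap K L (i X)‖ ^ n * ‖y - κ‖ ≤ ‖φ.act (X ^ n) y‖ := by
  induction n generalizing y with
  | zero => exact ⟨0, φ.act_zero _, by simp [act_one]⟩
  | succ n ih =>
    obtain ⟨κ₁, h₁, h₁'⟩ := ih (φ.act X y)
    obtain ⟨κ₂, rfl⟩ := φ.act_surjective hi X X_ne_zero κ₁
    obtain ⟨κ₃, h₃, h₃'⟩ := φ.exists_ker_near hi (y - κ₂)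
    refine ⟨κ₂ + κ₃, ?_, ?_⟩
    · rw [pow_succ, act_mul, act_add, h₃, add_zero, h₁]
    · rw [act_sub] at h₃'
      rw [pow_succ, pow_succ, act_mul, mul_assoc, ← sub_sub]
      exact (mul_le_mul_of_nonneg_left h₃' (by positivity)).trans h₁'

theorem norm_torsion_le (hi : Function.Injective i) (hθ : 1 < ‖algebraMap K L (i X)‖) :
    ∃ R : ℝ, ∀ x ∈ φ.torsion L, ‖x‖ ≤ R := by
  obtain ⟨R, hR⟩ := ((φ.finite_ker (L := L) hi X X_ne_zero).image norm).bddAbove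
  refine ⟨R, fun x hx => ?_⟩
  by_contra! hlt
  obtain ⟨a, ha, hax⟩ := hx
  have hR0 : 0 ≤ R := by simpa using hR ⟨0, φ.act_zero X, rfl⟩
  have key : ∀ n : ℕ, ‖algebraMap K L (i X)‖ ^ n * ‖x‖ ≤ ‖φ.act (X ^ n) x‖ := by
    intro n
    induction n with
    | zero => simp [act_one]
    | succ n ih =>
      have hbig : R < ‖φ.act (X ^ n) x‖ := by
        have := one_le_pow₀ hθ.le (n := n)
        nlinarith [norm_nonneg x]
      rw [pow_succ', pow_succ', act_mul, mul_assoc]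
      refine (mul_le_mul_of_nonneg_left ih (norm_nonneg _)).trans ?_
      refine φ.norm_act_ge X _ fun κ hκ => ?_
      have hκR : ‖κ‖ ≤ R := hR ⟨κ, hκ, rfl⟩
      have h1 := IsUltrametricDist.norm_add_le_max (φ.act (X ^ n) x - κ) κ
      rw [sub_add_cancel] at h1
      rcases le_max_iff.1 h1 with h | h
      · exact h
      · linarith
  obtain ⟨B, hB⟩ := ((φ.finite_ker (L := L) hi a ha).image norm).bddAbove
  obtain ⟨n, hn⟩ := pow_unbounded_of_one_lt (B / ‖x‖) hθ
  have hxpos : 0 < ‖x‖ := hR0.trans_lt hlt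
  rw [div_lt_iff₀ hxpos] at hn
  have h2 : ‖φ.act (X ^ n) x‖ ≤ B := hB ⟨_, by
    simp only [Set.mem_ofPred_eq]
    rw [← act_mul, mul_comm, act_mul, hax, act_zero], rfl⟩
  linarith [key n]

theorem totallyBounded_torsion (hi : Function.Injective i)
    (hθ : 1 < ‖algebraMap K L (i X)‖) : TotallyBounded (φ.torsion L : Set L) := by
  obtain ⟨R, hR⟩ := φ.norm_torsion_le (L := L) hi hθ
  rw [Metric.totallyBounded_iff]
  intro ε hε
  obtain ⟨n, hn⟩ := pow_unbounded_of_one_lt (R / ε) hθ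
  refine ⟨_, φ.finite_ker (L := L) hi (X ^ n) (pow_ne_zero n X_ne_zero), fun x hx => ?_⟩
  obtain ⟨κ, hκ, hle⟩ := φ.exists_ker_pow_near hi n x
  have hx' : φ.act (X ^ n) x ∈ φ.torsion L := by
    obtain ⟨a, ha, hax⟩ := hx
    exact ⟨a, ha, by rw [← act_mul, mul_comm, act_mul, hax, act_zero]⟩
  simp only [Set.mem_iUnion, Metric.mem_ball, dist_eq_norm]
  refine ⟨κ, hκ, ?_⟩
  rw [div_lt_iff₀ hε] at hn
  have h3 := hR _ hx'
  have hpos : 0 < ‖algebraMap K L (i X)‖ ^ n := by positivity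
  by_contra! hc
  nlinarith [mul_le_mul_of_nonneg_left hc hpos.le]

end TotallyBounded

end DrinfeldModule

/-! ### Heights -/

/-- A family of nontrivial nonarchimedean absolute values on `K` satisfying the product formula. -/
structure ProductFormulaFamily (K : Type*) [Field K] (ι : Type*) where
  abv : ι → AbsoluteValue K ℝ
  nontrivial : ∀ v, (abv v).IsNontrivial
  nonarch : ∀ v, IsNonarchimedean (abv v)
  finite : ∀ x : K, x ≠ 0 → {v | abv v x ≠ 1}.Finite
  product_formula : ∀ x : K, x ≠ 0 → ∏ᶠ v, abv v x = 1

/-- The contribution of a place `v` of `K` to the height of an algebraic element `x`: the average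
of `log⁺ |y|_v` over the conjugates `y` of `x` (counted with multiplicity) in an algebraic closure
of the completion `K_v`, where `|·|_v` is the unique extension of the absolute value of `K_v`. -/
def localHeight (v : AbsoluteValue K ℝ) {L : Type*} [Field L] [Algebra K L] (x : L) : ℝ :=
  (((minpoly K x).aroots (AlgebraicClosure v.Completion)).map fun y =>
    Real.posLog (spectralNorm v.Completion (AlgebraicClosure v.Completion) y)).sum
      / (minpoly K x).natDegree

/-- The absolute logarithmic Weil height with respect to the family `M`. -/
def weilHeight {ι : Type*} (M : ProductFormulaFamily K ι) {L : Type*} [Field L] [Algebra K L]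
    (x : L) : ℝ :=
  ∑ᶠ v, localHeight (M.abv v) x

/-- The canonical height `ĥ(x) = lim h(φ_{t^n}(x)) / deg(φ_t)^n`. -/
def canonicalHeight {ι : Type*} (φ : DrinfeldModule i) (M : ProductFormulaFamily K ι)
    {L : Type*} [Field L] [Algebra K L] (x : L) : ℝ :=
  limUnder atTop fun n : ℕ =>
    weilHeight M (φ.act (X ^ n) x) / ((φ.toFun X).natDegree : ℝ) ^ n

/-- The canonical height of a point of affine space: the sum of the heights of the coordinates. -/
def canonicalHeightVec {ι : Type*} (φ : DrinfeldModule i) (M : ProductFormulaFamily K ι)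
    {L : Type*} [Field L] [Algebra K L] {N : ℕ} (x : Fin N → L) : ℝ :=
  ∑ j, canonicalHeight φ M (x j)

/-! ### Subvarieties of affine space

`Ω` is an algebraic closure of `K`, and `K^sep` is the separable closure of `K` in `Ω`. Closed
subvarieties are identified with their sets of `Ω`-points. -/

section Varieties

variable {Ω : Type*} [Field Ω] [Algebra K Ω] {N : ℕ}

/-- `V ⊆ Ω^N` is Zariski closed and defined by polynomials with coefficients in `K^sep`. -/
def IsSubvariety (K : Type*) [Field K] {Ω : Type*} [Field Ω] [Algebra K Ω] {N : ℕ}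
    (V : Set (Fin N → Ω)) : Prop :=
  ∃ I : Ideal (MvPolynomial (Fin N) (separableClosure K Ω)), V = MvPolynomial.zeroLocus Ω I

/-- A subset of `Ω^N` is irreducible for the Zariski topology: its vanishing ideal is prime. -/
def IsIrred (K : Type*) [Field K] {Ω : Type*} [Field Ω] [Algebra K Ω] {N : ℕ}
    (V : Set (Fin N → Ω)) : Prop :=
  (MvPolynomial.vanishingIdeal (separableClosure K Ω) V).IsPrime

/-- `S` is a Zariski dense subset of `V`. -/
def IsZariskiDenseIn (K : Type*) [Field K] {Ω : Type*} [Field Ω] [Algebra K Ω] {N : ℕ}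
    (S V : Set (Fin N → Ω)) : Prop :=
  S ⊆ V ∧ MvPolynomial.zeroLocus Ω (MvPolynomial.vanishingIdeal (separableClosure K Ω) S) = V

/-- An algebraic `φ`-submodule of `𝔾_a^N`: a subvariety over `K^sep` which is a subgroup and is
invariant under the diagonal action of `φ`. -/
structure IsAlgebraicSubmodule (φ : DrinfeldModule i) (V : Set (Fin N → Ω)) : Prop where
  isSubvariety : IsSubvariety K V
  zero_mem : 0 ∈ V
  add_mem : ∀ x ∈ V, ∀ y ∈ V, x + y ∈ V
  act_mem : ∀ a : Fq[X], ∀ x ∈ V, (fun j => φ.act a (x j)) ∈ V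

/-- A torsion point of the diagonal action of `φ` on `𝔾_a^N`. -/
def IsTorsionPoint (φ : DrinfeldModule i) (x : Fin N → Ω) : Prop :=
  ∃ a : Fq[X], a ≠ 0 ∧ ∀ j, φ.act a (x j) = 0

/-- A torsion subvariety: a translate of an irreducible algebraic `φ`-submodule by a torsion
point. -/
def IsTorsionSubvariety (φ : DrinfeldModule i) (V : Set (Fin N → Ω)) : Prop :=
  ∃ (W : Set (Fin N → Ω)) (α : Fin N → Ω), IsAlgebraicSubmodule φ W ∧ IsIrred K W ∧
    IsTorsionPoint φ α ∧ V = (fun x => α + x) '' W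

/-- The maximal torsion subvarieties of `V`: the maximal elements, for inclusion, of the set of
torsion subvarieties contained in `V`. -/
def maximalTorsionSubvarieties (φ : DrinfeldModule i) (V : Set (Fin N → Ω)) :
    Set (Set (Fin N → Ω)) :=
  {W | Maximal (fun W => IsTorsionSubvariety φ W ∧ W ⊆ V) W}

/-- A sequence of points is strict if every proper torsion subvariety contains `x k` for only
finitely many `k`. -/
def IsStrict (φ : DrinfeldModule i) (x : ℕ → Fin N → Ω) : Prop :=
  ∀ V : Set (Fin N → Ω), IsTorsionSubvariety φ V → V ≠ Set.univ → {k | x k ∈ V}.Finite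

/-- The inclusion `𝔾_a^N(K^sep) → 𝔾_a^N(Ω)`. -/
def toAlg (x : Fin N → separableClosure K Ω) : Fin N → Ω := fun j => (x j : Ω)

/-- The orbit `O(x)` of `x ∈ 𝔾_a^N(K^sep)` under the diagonal action of `Gal(K^sep / K)`. -/
def galOrbit (x : Fin N → separableClosure K Ω) : Set (Fin N → separableClosure K Ω) :=
  Set.range fun (σ : separableClosure K Ω ≃ₐ[K] separableClosure K Ω) => fun j => σ (x j)

end Varieties

/-! ### The place at infinity and the field `ℂ_∞` -/

/-- An extension of `v_∞` to `K`: a nonarchimedean absolute value with `|f| = q ^ deg f` for every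
nonzero `f ∈ 𝔽_q[t]`. -/
structure InftyPlace (i : Fq[X] →ₐ[Fq] K) where
  abv : AbsoluteValue K ℝ
  nonarch : IsNonarchimedean abv
  abv_poly : ∀ f : Fq[X], f ≠ 0 → abv (i f) = (Fintype.card Fq : ℝ) ^ f.natDegree

namespace InftyPlace

variable (w : InftyPlace i)

/-- `K_∞`, the completion of `K` at `v_∞`. -/
abbrev Kinf : Type _ := w.abv.Completion

theorem norm_coe (x : K) : ‖algebraMap K w.Kinf x‖ = w.abv x := by
  have h : algebraMap K w.Kinf x = ((WithAbs.toAbs w.abv x : WithAbs w.abv) : w.Kinf) := rfl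
  rw [h, UniformSpace.Completion.norm_coe, WithAbs.norm_eq_apply_ofAbs]

instance : IsUltrametricDist w.Kinf := by
  refine IsUltrametricDist.isUltrametricDist_of_forall_norm_add_le_max_norm fun x y => ?_
  induction x, y using UniformSpace.Completion.induction_on₂ with
  | hp => exact isClosed_le (by fun_prop) (by fun_prop)
  | ih x y =>
    rw [← UniformSpace.Completion.coe_add]
    simp only [UniformSpace.Completion.norm_coe, WithAbs.norm_eq_apply_ofAbs, WithAbs.ofAbs_add]
    exact w.nonarch _ _

theorem one_lt_norm : 1 < ‖algebraMap K w.Kinf (i X)‖ := by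
  rw [norm_coe, w.abv_poly X X_ne_zero, natDegree_X, pow_one]
  exact_mod_cast Fintype.one_lt_card

theorem injective (w : InftyPlace i) : Function.Injective i := by
  rw [injective_iff_map_eq_zero]
  intro f hf
  by_contra h
  have h1 := w.abv_poly f h
  rw [hf, map_zero] at h1
  have : (0 : ℝ) < (Fintype.card Fq : ℝ) ^ f.natDegree := by
    have : (0 : ℝ) < Fintype.card Fq := by exact_mod_cast Fintype.card_pos
    positivity
  linarith

instance : NontriviallyNormedField w.Kinf where
  non_trivial := ⟨_, w.one_lt_norm⟩

/-- A fixed algebraic closure `K_∞^alg` of `K_∞`, with the unique extension of the absolute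
value. -/
abbrev KinfAlg : Type _ := AlgebraicClosure w.Kinf

instance : NormedField w.KinfAlg := spectralNorm.normedField w.Kinf w.KinfAlg

instance : IsUltrametricDist w.KinfAlg :=
  IsUltrametricDist.isUltrametricDist_of_forall_norm_add_le_max_norm
    (isNonarchimedean_spectralNorm (K := w.Kinf) (L := w.KinfAlg))

/-- `ℂ_∞`, the completion of `K_∞^alg`. -/
abbrev Cinf : Type _ := UniformSpace.Completion w.KinfAlg

/-- `K^alg`, the algebraic closure of `K` inside `K_∞^alg`. -/
abbrev Kalg : IntermediateField K w.KinfAlg := algebraicClosure K w.KinfAlg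

/-- `K^sep`, the separable closure of `K` inside `K^alg`. -/
abbrev Ksep : IntermediateField K w.Kalg := separableClosure K w.Kalg

/-- The inclusion `K^alg → ℂ_∞`. -/
def toCinf : w.Kalg →+* w.Cinf :=
  (UniformSpace.Completion.coeRingHom (α := w.KinfAlg)).comp (algebraMap w.Kalg w.KinfAlg)

theorem one_lt_norm' : 1 < ‖algebraMap K w.KinfAlg (i X)‖ := by
  rw [IsScalarTower.algebraMap_apply K w.Kinf w.KinfAlg]
  exact w.one_lt_norm.trans_eq (spectralNorm_extends (L := w.KinfAlg) _).symm

end InftyPlace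

/-! ### The equilibrium measures -/

section Measures

variable (φ : DrinfeldModule i) (w : InftyPlace i)

/-- `T`, the closure in `ℂ_∞` of the torsion submodule `φ_tor ⊆ K^alg`. -/
def torsionClosure : AddSubgroup w.Cinf :=
  ((φ.torsion w.Kalg).map w.toCinf.toAddMonoidHom).topologicalClosure

instance : CompactSpace (torsionClosure φ w) := by
  refine isCompact_iff_compactSpace.1 (?_ : IsCompact (torsionClosure φ w : Set w.Cinf))
  refine TotallyBounded.isCompact_of_isClosed ?_ (AddSubgroup.isClosed_topologicalClosure _)
  refine TotallyBounded.closure ?_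
  refine ((φ.totallyBounded_torsion (L := w.KinfAlg) w.injective w.one_lt_norm').image
    (UniformSpace.Completion.uniformContinuous_coe w.KinfAlg)).subset ?_
  rintro _ ⟨x, ⟨a, ha, hx⟩, rfl⟩
  refine ⟨algebraMap w.Kalg w.KinfAlg x, ⟨a, ha, ?_⟩, rfl⟩
  have := congrArg (algebraMap w.Kalg w.KinfAlg) hx
  rw [map_zero] at this
  rw [← this, DrinfeldModule.act, DrinfeldModule.act, aeval_algebraMap_apply]

instance : MeasurableSpace (torsionClosure φ w) := borel _

instance : BorelSpace (torsionClosure φ w) := ⟨rfl⟩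

/-- `ν`, the Haar measure of total mass `1` on the compact group `T`. -/
def nu : MeasureTheory.Measure (torsionClosure φ w) := MeasureTheory.Measure.addHaarMeasure ⊤

instance (g : ℕ) : MeasurableSpace (Fin g → w.Cinf) := borel _

instance (g : ℕ) : BorelSpace (Fin g → w.Cinf) := ⟨rfl⟩

/-- `ν^(g)`, the product measure on `T^g`, seen as a Borel measure on `ℂ_∞^g`. -/
def nuPow (g : ℕ) : MeasureTheory.Measure (Fin g → w.Cinf) :=
  (MeasureTheory.Measure.pi fun _ : Fin g => nu φ w).map fun z j => (z j : w.Cinf)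

variable {w}

/-- The inclusion `𝔾_a^g(K^sep) → ℂ_∞^g`. -/
def toCinfVec {g : ℕ} (x : Fin g → w.Ksep) : Fin g → w.Cinf := fun j => w.toCinf (x j)

/-- The probability measure `(1 / #O(x)) ∑_{y ∈ O(x)} δ_y` on `ℂ_∞^g`. -/
def diracOrbit {g : ℕ} (x : Fin g → w.Ksep) : MeasureTheory.Measure (Fin g → w.Cinf) :=
  ((galOrbit x).ncard : ENNReal)⁻¹ •
    MeasureTheory.Measure.sum fun y : galOrbit x => MeasureTheory.Measure.dirac (toCinfVec y.1)

end Measures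

/-- Weak convergence of a sequence of Borel measures. -/
def WeaklyConverges {S : Type*} [TopologicalSpace S] [MeasurableSpace S]
    (μ : ℕ → MeasureTheory.Measure S) (μ₀ : MeasureTheory.Measure S) : Prop :=
  ∀ f : BoundedContinuousFunction S ℝ,
    Tendsto (fun k => ∫ z, f z ∂(μ k)) atTop (𝓝 (∫ z, f z ∂μ₀))

/-! ### The equidistribution and Bogomolov statements -/

section Statements

variable {ι : Type*} (φ : DrinfeldModule i) (w : InftyPlace i) (M : ProductFormulaFamily K ι)

/-- The equidistribution conjecture for points of small height, for `φ` and `𝔾_a^g`: if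
`End(φ) = A`, then `δ̄_{x_k}` converges weakly to `ν^(g)` for every strict sequence `x_k` in
`𝔾_a^g(K^sep)` with `ĥ(x_k) → 0`. -/
def SmallPointsConjecture (g : ℕ) : Prop :=
  φ.EndEqA w.Ksep →
    ∀ x : ℕ → Fin g → w.Ksep, IsStrict φ (fun k => toAlg (x k)) →
      Tendsto (fun k => canonicalHeightVec φ M (x k)) atTop (𝓝 0) →
      WeaklyConverges (fun k => diracOrbit (x k)) (nuPow φ w g)

/-- The Bogomolov conjecture for `φ` and `𝔾_a^g`: if `End(φ) = A` and `V` is an irreducible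
`K^sep`-subvariety in which, for every `n ≥ 1`, the points of `V(K^sep)` of height less than `1/n`
are Zariski dense, then `V` is a torsion subvariety. -/
def BogomolovConjecture (g : ℕ) : Prop :=
  φ.EndEqA w.Ksep →
    ∀ V : Set (Fin g → w.Kalg), IsSubvariety K V → IsIrred K V →
      (∀ n : ℕ, 1 ≤ n →
        IsZariskiDenseIn K
          (toAlg '' {x : Fin g → w.Ksep | toAlg x ∈ V ∧ canonicalHeightVec φ M x < 1 / (n : ℝ)})
          V) →
      IsTorsionSubvariety φ V

end Statements

end Generic
end
end DrinfeldBogomolov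

namespace DrinfeldBogomolov

/-! ### Additive polynomials -/

/-! Write A for the ring `Fq[X]` and t for its variable. The core is the Bogomolov statement. Let V
be irreducible with dense sets of points of arbitrarily small height, and put V inside a torsion
subvariety of least dimension g. That torsion subvariety is parametrized by 𝔾_a^g through a matrix
over A, so V becomes a closed V' ⊆ 𝔾_a^g contained in no proper torsion subvariety. Torsion
subvarieties are countable in number, so a diagonal choice gives a strict sequence in V' with
heights tending to 0, and its Galois orbits equidistribute to ν^(g). If V' ≠ 𝔾_a^g, a nonzero
polynomial vanishes on V'. It divides a nonzero Q over K, and Q vanishes on all these orbits.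
Integrating min(1, |Q|) shows that Q vanishes on T^g, hence at all torsion points, so Q = 0, a
contradiction (`eq_zero_of_weaklyConverges`, `isTorsionSubvariety_of_dense`).

The parametrization is where End(φ) = A enters. A proper closed φ-stable subgroup satisfies an
additive relation ∑ f_j(x_j) = 0 (`exists_additive_relation`). Right division of additive
polynomials shows that a minimal such relation intertwines φ with some ψ, and composing with a dual
isogeny turns every f_j into an endomorphism of φ, that is, an element of A (`exists_act_relation`).
For an irreducible submodule W the relations over A form a saturated submodule of A^N; as A is a
PID, the quotient is free, and W is the image of a split matrix (`exists_eq_range_matAct`).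

The finiteness and height statement follows by Noetherian induction (`exists_isTorsionCover`). If
the small points of an irreducible V are not dense, V may be replaced by the closure of its points
of height below some 1/n: torsion points have height 0 and are dense in torsion subvarieties, so no
torsion subvariety of V is lost. Reducible V are split in two. -/

/-- `f` is additive as a function on `L`. -/
def IsAdditivePoly {L : Type*} [Semiring L] (f : L[X]) : Prop :=
  ∀ x y, f.eval (x + y) = f.eval x + f.eval y

namespace IsAdditivePoly

section Basic

variable {L : Type*} [Field L] {f g : L[X]}

theorem eval_zero (hf : IsAdditivePoly f) : f.eval 0 = 0 := by
  have := hf 0 0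
  rw [add_zero] at this
  exact left_eq_add.1 this

theorem coeff_zero (hf : IsAdditivePoly f) : f.coeff 0 = 0 := by
  rw [coeff_zero_eq_eval_zero, hf.eval_zero]

theorem zero : IsAdditivePoly (0 : L[X]) := fun x y => by simp

theorem X : IsAdditivePoly (Polynomial.X : L[X]) := fun x y => by simp

theorem add (hf : IsAdditivePoly f) (hg : IsAdditivePoly g) : IsAdditivePoly (f + g) :=
  fun x y => by rw [eval_add, eval_add, eval_add, hf, hg]; ring

theorem sub (hf : IsAdditivePoly f) (hg : IsAdditivePoly g) : IsAdditivePoly (f - g) :=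
  fun x y => by rw [eval_sub, eval_sub, eval_sub, hf, hg]; ring

theorem comp (hf : IsAdditivePoly f) (hg : IsAdditivePoly g) : IsAdditivePoly (f.comp g) :=
  fun x y => by simp only [eval_comp]; rw [hg, hf]

theorem C_mul (c : L) (hf : IsAdditivePoly f) : IsAdditivePoly (C c * f) :=
  fun x y => by simp only [eval_mul, eval_C]; rw [hf]; ring

theorem X_pow (p : ℕ) [Fact p.Prime] [CharP L p] (m : ℕ) :
    IsAdditivePoly (Polynomial.X ^ p ^ m : L[X]) :=
  fun x y => by simp only [eval_pow, eval_X]; exact add_pow_char_pow x y p m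

theorem eval_sum (hf : IsAdditivePoly f) {σ : Type*} (s : Finset σ) (x : σ → L) :
    f.eval (∑ j ∈ s, x j) = ∑ j ∈ s, f.eval (x j) :=
  map_sum (AddMonoidHom.mk' (fun z => f.eval z) hf) x s

theorem comp_add (h : IsAdditivePoly f) [Infinite L] (u v : L[X]) :
    f.comp (u + v) = f.comp u + f.comp v :=
  Polynomial.funext fun x => by simp only [eval_comp, eval_add]; rw [h]

theorem natDegree_pos (hf : IsAdditivePoly f) (h : f ≠ 0) : 0 < f.natDegree := by
  by_contra! h0
  rw [Nat.le_zero] at h0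
  rw [eq_C_of_natDegree_eq_zero h0, hf.coeff_zero, C_0] at h
  exact h rfl

end Basic

section AlgClosed

variable {L : Type*} [Field L] [IsAlgClosed L] {f g : L[X]}

theorem surjective (hf : IsAdditivePoly f) (h : f ≠ 0) (y : L) : ∃ x, f.eval x = y := by
  have hd : (f - C y).degree ≠ 0 := by
    rw [degree_sub_C (natDegree_pos_iff_degree_pos.1 (hf.natDegree_pos h))]
    exact (natDegree_pos_iff_degree_pos.1 (hf.natDegree_pos h)).ne'
  obtain ⟨x, hx⟩ := IsAlgClosed.exists_root _ hd
  exact ⟨x, by simpa [IsRoot.def, sub_eq_zero] using hx⟩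

/-- Differentiate f(X + y) = f(X) + f(y) in X and evaluate at 0. -/
theorem derivative_eq (hf : IsAdditivePoly f) : derivative f = C (f.coeff 1) := by
  have : Infinite L := IsAlgClosed.instInfinite
  have h0 : (derivative f).eval 0 = f.coeff 1 := by
    rw [← coeff_zero_eq_eval_zero, coeff_derivative]; simp
  refine Polynomial.funext fun y => ?_
  have h1 : f.comp (Polynomial.X + C y) = f + C (f.eval y) :=
    Polynomial.funext fun x => by simp [eval_comp, hf x y]
  have h2 := congrArg (fun u => (derivative u).eval 0) h1
  simp only [derivative_comp, derivative_add, derivative_X, derivative_C, add_zero,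
    one_mul, eval_comp, eval_add, eval_X, eval_C, zero_add] at h2
  rw [h2, h0, eval_C]

/-- Without its linear term, f has zero derivative, so what remains is a polynomial in X^p. The
contracted polynomial is additive because every element of L is a p-th power. -/
theorem exists_eq_add_expand (p : ℕ) [Fact p.Prime] [CharP L p] (hf : IsAdditivePoly f) :
    ∃ g : L[X], IsAdditivePoly g ∧ f = C (f.coeff 1) * Polynomial.X + expand L p g := by
  have hp : p ≠ 0 := (Fact.out : p.Prime).ne_zero
  have hd : derivative (f - C (f.coeff 1) * Polynomial.X) = 0 := by
    rw [derivative_sub, hf.derivative_eq]; simp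
  have he := expand_contract p hd hp
  set g := contract p (f - C (f.coeff 1) * Polynomial.X) with hg
  refine ⟨g, fun x y => ?_, by rw [he]; ring⟩
  obtain ⟨x, rfl⟩ := IsAlgClosed.exists_pow_nat_eq x (Fact.out : p.Prime).pos
  obtain ⟨y, rfl⟩ := IsAlgClosed.exists_pow_nat_eq y (Fact.out : p.Prime).pos
  rw [← add_pow_char, ← expand_eval, ← expand_eval, ← expand_eval, he]
  exact hf.sub (X.C_mul _) x y

theorem exists_eq_pow (p : ℕ) [Fact p.Prime] [CharP L p] (hf : IsAdditivePoly f) {n : ℕ} (hn : f.coeff n ≠ 0) : ∃ m, n = p ^ m := by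
  induction n using Nat.strong_induction_on generalizing f with
  | _ n ih =>
    rcases Nat.eq_zero_or_pos n with rfl | h0
    · exact absurd hf.coeff_zero hn
    rcases eq_or_ne n 1 with rfl | h1
    · exact ⟨0, (pow_zero p).symm⟩
    obtain ⟨g, hg, hfg⟩ := hf.exists_eq_add_expand p
    have hp := (Fact.out : p.Prime)
    rw [hfg, coeff_add, coeff_C_mul, coeff_X_of_ne_one h1, mul_zero, zero_add,
      coeff_expand hp.pos] at hn
    split_ifs at hn with hd
    · obtain ⟨m, hm⟩ := ih _ (Nat.div_lt_self h0 hp.one_lt) hg hn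
      refine ⟨m + 1, ?_⟩
      rw [pow_succ, ← hm, Nat.div_mul_cancel hd]
    · exact absurd rfl hn

/-- An additive polynomial without linear term is a `p`-th power. -/
theorem exists_pow_eq (p : ℕ) [Fact p.Prime] [CharP L p] (hf : IsAdditivePoly f) (h : f.coeff 1 = 0) :
    ∃ g : L[X], IsAdditivePoly g ∧ f = g ^ p := by
  obtain ⟨g, hg, hfg⟩ := hf.exists_eq_add_expand p
  rw [h, C_0, zero_mul, zero_add] at hfg
  have hp := (Fact.out : p.Prime)
  let e := (frobeniusEquiv L p)
  have hgp : f = (g.map (e.symm : L →+* L)) ^ p := by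
    rw [hfg, ← Polynomial.map_frobenius_expand, Polynomial.map_expand, Polynomial.map_map]
    have : (frobenius L p).comp (e.symm : L →+* L) = RingHom.id L := by
      ext x; exact e.apply_symm_apply x
    rw [this, Polynomial.map_id]
  refine ⟨_, fun x y => ?_, hgp⟩
  have hinj := frobenius_inj L p
  apply hinj
  rw [map_add]
  simp only [frobenius_def, ← eval_pow, ← hgp]
  exact hf x y

/-- Right division with remainder in the ring of additive polynomials under composition. -/
theorem exists_sub_comp_degree_lt (p : ℕ) [Fact p.Prime] [CharP L p] (hf : IsAdditivePoly f) (h : f ≠ 0) (hg : IsAdditivePoly g) :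
    ∃ u : L[X], IsAdditivePoly u ∧ (g - u.comp f).degree < f.degree := by
  induction hn : g.natDegree using Nat.strong_induction_on generalizing g with
  | _ n ih =>
    subst hn
    by_cases hlt : g.degree < f.degree
    · exact ⟨0, zero, by simpa using hlt⟩
    have hg0 : g ≠ 0 := by
      rintro rfl
      exact hlt (by rw [degree_zero]; exact bot_lt_iff_ne_bot.2 (degree_eq_bot.not.2 h))
    obtain ⟨m, hm⟩ := hg.exists_eq_pow p (n := g.natDegree) (leadingCoeff_ne_zero.2 hg0)
    obtain ⟨n, hn⟩ := hf.exists_eq_pow p (n := f.natDegree) (leadingCoeff_ne_zero.2 h)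
    have hp := (Fact.out : p.Prime)
    have hle : n ≤ m := by
      rw [← Nat.pow_le_pow_iff_right hp.one_lt, ← hn, ← hm]
      exact natDegree_le_natDegree (not_lt.1 hlt)
    -- Both degrees are powers of p, so a single term c X^(p^(m-n)) composed with f can match the
    -- leading term of g.
    set c := g.leadingCoeff / f.leadingCoeff ^ p ^ (m - n) with hc
    have hfl : f.leadingCoeff ≠ 0 := leadingCoeff_ne_zero.2 h
    have hgl : g.leadingCoeff ≠ 0 := leadingCoeff_ne_zero.2 hg0
    have hc0 : c ≠ 0 := div_ne_zero hgl (pow_ne_zero _ hfl)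
    have hu : IsAdditivePoly (C c * Polynomial.X ^ p ^ (m - n) : L[X]) := (X_pow p _).C_mul c
    have hcomp : (C c * Polynomial.X ^ p ^ (m - n)).comp f = C c * f ^ p ^ (m - n) := by simp
    have hlead : (C c * f ^ p ^ (m - n)).leadingCoeff = g.leadingCoeff := by
      rw [leadingCoeff_mul, leadingCoeff_C, leadingCoeff_pow, hc,
        div_mul_cancel₀ _ (pow_ne_zero _ hfl)]
    have hnd : (C c * f ^ p ^ (m - n)).natDegree = g.natDegree := by
      rw [natDegree_C_mul hc0, natDegree_pow, hn, hm, ← pow_add, Nat.sub_add_cancel hle]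
    have hdeg : g.degree = (C c * f ^ p ^ (m - n)).degree := by
      rw [degree_eq_natDegree hg0, ← hnd, ← degree_eq_natDegree]
      exact mul_ne_zero (C_ne_zero.2 hc0) (pow_ne_zero _ h)
    have hsub := degree_sub_lt_left hdeg hg0 hlead.symm
    rw [← hcomp] at hsub
    by_cases h0 : g - (C c * Polynomial.X ^ p ^ (m - n)).comp f = 0
    · refine ⟨_, hu, ?_⟩
      rw [h0, degree_zero]
      exact bot_lt_iff_ne_bot.2 (degree_eq_bot.not.2 h)
    obtain ⟨u, hu', hlt'⟩ := ih _ (natDegree_lt_natDegree h0 hsub) (hg.sub (hu.comp hf)) rfl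
    refine ⟨u + C c * Polynomial.X ^ p ^ (m - n), hu'.add hu, ?_⟩
    rwa [Polynomial.add_comp, add_comm (u.comp f), ← sub_sub]

theorem separable (hf : IsAdditivePoly f) (h : f.coeff 1 ≠ 0) : f.Separable := by
  rw [Polynomial.separable_def, hf.derivative_eq]
  exact (isCoprime_one_right).of_isCoprime_of_dvd_right
    (⟨C (f.coeff 1)⁻¹, by rw [← Polynomial.C_mul, mul_inv_cancel₀ h, C_1]⟩)

/-- If the kernel of the separable additive polynomial `f` is contained in that of `g`, then `g`
factors through `f`. -/
theorem exists_eq_comp (p : ℕ) [Fact p.Prime] [CharP L p] (hf : IsAdditivePoly f) (h : f.coeff 1 ≠ 0) (hg : IsAdditivePoly g)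
    (hker : ∀ x, f.eval x = 0 → g.eval x = 0) : ∃ u : L[X], IsAdditivePoly u ∧ g = u.comp f := by
  have h0 : f ≠ 0 := by rintro rfl; simp at h
  obtain ⟨u, hu, hlt⟩ := hf.exists_sub_comp_degree_lt p h0 hg
  refine ⟨u, hu, ?_⟩
  by_contra hne
  have hr : g - u.comp f ≠ 0 := sub_ne_zero.2 hne
  -- As f splits with simple roots, divisibility by f only has to be tested at the zeros of f.
  have hdvd : f ∣ g - u.comp f := by
    refine (dvd_of_eq (IsAlgClosed.splits f).eq_prod_roots).trans ?_
    refine (isUnit_C.2 (isUnit_iff_ne_zero.2 (leadingCoeff_ne_zero.2 h0))).mul_left_dvd.2 ?_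
    refine (Multiset.prod_X_sub_C_dvd_iff_le_roots hr _).2 ?_
    rw [Multiset.le_iff_subset (nodup_roots (hf.separable h))]
    intro x hx
    rw [mem_roots hr, IsRoot.def, eval_sub, eval_comp]
    have hx' : f.eval x = 0 := (mem_roots h0).1 hx
    rw [hx', hu.eval_zero, hker x hx', sub_zero]
  exact absurd (degree_le_of_dvd hdvd hr) (not_le.2 hlt)

end AlgClosed

end IsAdditivePoly
/-! ### Subgroups of affine space that are not Zariski dense -/

section Translate

variable {σ L : Type*} [Field L]

/-- The polynomial `P(X + x)`. -/
noncomputable def translate (x : σ → L) : MvPolynomial σ L →ₐ[L] MvPolynomial σ L :=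
  MvPolynomial.aeval fun j => MvPolynomial.X j + MvPolynomial.C (x j)

theorem eval_translate (x y : σ → L) (P : MvPolynomial σ L) :
    MvPolynomial.eval y (translate x P) = MvPolynomial.eval (y + x) P := by
  induction P using MvPolynomial.induction_on with
  | C a => simp [translate]
  | add P Q hP hQ => simp [hP, hQ]
  | mul_X P j hP => rw [map_mul, map_mul, map_mul, hP]; simp [translate]

/-- Translation leaves the top-degree part unchanged; the induction splits off one variable. The
zero alternative is needed in degree 0, where the strict inequality cannot hold. -/
theorem translate_monomial_sub (x : σ → L) (n : ℕ) (s : σ →₀ ℕ) (hs : s.degree = n) :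
    translate x (MvPolynomial.monomial s 1) - MvPolynomial.monomial s 1 = 0 ∨
      (translate x (MvPolynomial.monomial s 1) - MvPolynomial.monomial s 1).totalDegree < n := by
  classical
  induction n generalizing s with
  | zero =>
    rw [Finsupp.degree_eq_zero_iff] at hs
    left; subst hs; simp [translate]
  | succ n ih =>
    right
    have hs0 : s ≠ 0 := by rintro rfl; simp at hs
    obtain ⟨j, hj⟩ := Finsupp.ne_iff.1 hs0
    have hle : Finsupp.single j 1 ≤ s := by
      rw [Finsupp.single_le_iff]; exact Nat.one_le_iff_ne_zero.2 hj
    obtain ⟨s', rfl⟩ := exists_add_of_le hle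
    have hs' : s'.degree = n := by
      rw [map_add, Finsupp.degree_single] at hs; omega
    set m : MvPolynomial σ L := MvPolynomial.monomial s' 1 with hm
    have hmon : MvPolynomial.monomial (Finsupp.single j 1 + s') (1 : L)
        = MvPolynomial.X j * m := by
      rw [hm, MvPolynomial.X, MvPolynomial.monomial_mul, one_mul]
    have hX : translate x (MvPolynomial.X j) = MvPolynomial.X j + MvPolynomial.C (x j) := by
      simp [translate]
    have hmd : m.totalDegree ≤ n := by
      refine (MvPolynomial.totalDegree_monomial_le _ _).trans (le_of_eq ?_)
      rw [← hs']; rfl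
    have hT : (translate x m).totalDegree ≤ n := by
      rcases ih s' hs' with h | h
      · rwa [sub_eq_zero.1 h]
      · have : translate x m = (translate x m - m) + m := by ring
        rw [this]
        exact (MvPolynomial.totalDegree_add _ _).trans (max_le h.le hmd)
    have h2 : (MvPolynomial.C (x j) * translate x m).totalDegree ≤ n :=
      (MvPolynomial.totalDegree_mul _ _).trans (by simpa using hT)
    rw [hmon, map_mul, hX,
      show (MvPolynomial.X j + MvPolynomial.C (x j)) * translate x m - MvPolynomial.X j * m
        = MvPolynomial.X j * (translate x m - m) + MvPolynomial.C (x j) * translate x m by ring]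
    have ih' := ih s' hs'
    rw [← hm] at ih'
    rcases ih' with h | h
    · rw [h, mul_zero, zero_add]; omega
    · refine lt_of_le_of_lt ((MvPolynomial.totalDegree_add _ _).trans (max_le ?_ h2))
        (Nat.lt_succ_self n)
      refine (MvPolynomial.totalDegree_mul _ _).trans ?_
      rw [MvPolynomial.totalDegree_X]; omega

theorem translate_sub (x : σ → L) (P : MvPolynomial σ L) :
    translate x P - P = 0 ∨ (translate x P - P).totalDegree < P.totalDegree := by
  classical
  have hP := P.as_sum
  have key : translate x P - P = ∑ s ∈ P.support, MvPolynomial.C (P.coeff s) *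
      (translate x (MvPolynomial.monomial s 1) - MvPolynomial.monomial s 1) := by
    conv_lhs => rw [hP]
    rw [map_sum, ← Finset.sum_sub_distrib]
    refine Finset.sum_congr rfl fun s _ => ?_
    rw [show MvPolynomial.monomial s (P.coeff s)
      = MvPolynomial.C (P.coeff s) * MvPolynomial.monomial s 1 by
        rw [MvPolynomial.C_mul_monomial, mul_one], map_mul, mul_sub]
    congr 2
    simp [translate]
  rcases Nat.eq_zero_or_pos P.totalDegree with h0 | h0
  · left
    rw [MvPolynomial.totalDegree_eq_zero_iff_eq_C.1 h0]
    simp [translate]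
  · right
    rw [key]
    refine lt_of_le_of_lt (MvPolynomial.totalDegree_finsetSum_le (d := P.totalDegree - 1)
      fun s hs => ?_) (Nat.sub_lt h0 one_pos)
    refine (MvPolynomial.totalDegree_mul _ _).trans ?_
    rw [MvPolynomial.totalDegree_C, zero_add]
    have hsd : s.degree ≤ P.totalDegree := MvPolynomial.le_totalDegree hs
    rcases translate_monomial_sub x _ s rfl with h | h
    · rw [h]; simp
    · omega

end Translate

section Relation

variable {σ L : Type*} [Fintype σ] [Field L] [Infinite L]

/-- A subgroup of `L ^ σ` on which some nonzero polynomial vanishes satisfies a nontrivial additive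
relation. -/
theorem exists_additive_relation (G : AddSubgroup (σ → L))
    (hG : ∃ P : MvPolynomial σ L, P ≠ 0 ∧ ∀ x ∈ G, MvPolynomial.eval x P = 0) :
    ∃ f : σ → L[X], f ≠ 0 ∧ (∀ j, IsAdditivePoly (f j)) ∧
      ∀ x ∈ G, ∑ j, (f j).eval (x j) = 0 := by
  classical
  let S : Set ℕ := {d | ∃ P : MvPolynomial σ L, P ≠ 0 ∧ (∀ x ∈ G, MvPolynomial.eval x P = 0) ∧
    P.totalDegree = d}
  have hS : S.Nonempty := by
    obtain ⟨P, h1, h2⟩ := hG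
    exact ⟨_, P, h1, h2, rfl⟩
  obtain ⟨P, hP0, hPG, hPd⟩ := Nat.sInf_mem hS
  have hmin : ∀ Q : MvPolynomial σ L, (∀ x ∈ G, MvPolynomial.eval x Q = 0) →
      Q.totalDegree < P.totalDegree → Q = 0 := by
    intro Q hQ hlt
    by_contra h
    rw [hPd] at hlt
    exact Nat.notMem_of_lt_sInf hlt ⟨Q, h, hQ, rfl⟩
  -- The difference vanishes on G and has smaller degree than P, which has least degree among
  -- nonzero polynomials vanishing on G.
  have hinv : ∀ w ∈ G, translate w P = P := by
    intro w hw
    rw [← sub_eq_zero]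
    rcases translate_sub w P with h | h
    · exact h
    · refine hmin _ (fun x hx => ?_) h
      rw [map_sub, eval_translate, hPG _ (G.add_mem hx hw), hPG x hx, sub_zero]
  have hpos : 0 < P.totalDegree := by
    by_contra! h
    have hC := MvPolynomial.totalDegree_eq_zero_iff_eq_C.1 (Nat.le_zero.1 h)
    have h0 := hPG 0 G.zero_mem
    rw [hC, MvPolynomial.eval_C] at h0
    rw [h0, MvPolynomial.C_0] at hC
    exact hP0 hC
  have hadd : ∀ y x, MvPolynomial.eval (y + x) P
      = MvPolynomial.eval y P + MvPolynomial.eval x P := by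
    intro y x
    -- Here x is arbitrary. At z ∈ G the value is P(z + x) - P(x), which is 0 by invariance of P
    -- under z; minimality of the degree applies again, so P is additive.
    have hQ : translate x P - P - MvPolynomial.C (MvPolynomial.eval x P) = 0 := by
      refine hmin _ (fun z hz => ?_) ?_
      · rw [map_sub, map_sub, eval_translate, hPG z hz, MvPolynomial.eval_C, sub_zero,
          add_comm, ← eval_translate, hinv z hz, sub_self]
      · refine lt_of_le_of_lt (MvPolynomial.totalDegree_sub_C_le _ _) ?_
        rcases translate_sub x P with h | h
        · rw [h, MvPolynomial.totalDegree_zero]; exact hpos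
        · exact h
    have := congrArg (MvPolynomial.eval y) hQ
    rw [map_sub, map_sub, eval_translate, MvPolynomial.eval_C, map_zero, sub_sub,
      sub_eq_zero] at this
    exact this
  -- The restriction of P to the j-th coordinate axis; additivity makes P the sum of these
  -- restrictions.
  let f : σ → L[X] := fun j =>
    MvPolynomial.aeval (fun k => if k = j then Polynomial.X else 0) P
  have hf : ∀ j t, (f j).eval t = MvPolynomial.eval (Pi.single j t) P := by
    intro j t
    have : ((Polynomial.evalRingHom t).comp (MvPolynomial.aeval
        (fun k => if k = j then (Polynomial.X : L[X]) else 0)).toRingHom)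
        = MvPolynomial.eval (Pi.single j t) := by
      refine MvPolynomial.ringHom_ext (fun r => by simp) fun k => ?_
      by_cases h : k = j
      · subst h; simp
      · simp [h]
    exact congrArg (fun g => g P) this
  have hsum : ∀ x : σ → L, MvPolynomial.eval x P = ∑ j, (f j).eval (x j) := by
    intro x
    have := map_sum (AddMonoidHom.mk' (fun y => MvPolynomial.eval y P) hadd)
      (fun j => Pi.single j (x j)) Finset.univ
    rw [Finset.univ_sum_single] at this
    simp only [AddMonoidHom.mk'_apply] at this
    rw [this]
    exact Finset.sum_congr rfl fun j _ => (hf j _).symm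
  refine ⟨f, ?_, fun j x y => ?_, fun x hx => by rw [← hsum, hPG x hx]⟩
  · intro h0
    refine hP0 (MvPolynomial.funext fun x => ?_)
    rw [hsum, h0]; simp
  · rw [hf, hf, hf, Pi.single_add, hadd]

end Relation
/-! ### Relations on `φ`-stable subgroups -/

namespace DrinfeldModule

variable {Fq : Type*} [Field Fq] [Fintype Fq] {K : Type*} [Field K] [Algebra Fq K]
  {i : Fq[X] →ₐ[Fq] K} (φ : DrinfeldModule i)

/-- `φ_a` as a polynomial over an extension `L` of `K`. -/
noncomputable def poly (L : Type*) [Field L] [Algebra K L] (a : Fq[X]) : L[X] :=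
  (φ.toFun a).map (algebraMap K L)

section Poly

variable {L : Type*} [Field L] [Algebra K L]

theorem eval_poly (a : Fq[X]) (x : L) : (φ.poly L a).eval x = φ.act a x :=
  (φ.act_eq_eval a x).symm

theorem isAdditivePoly_poly (a : Fq[X]) : IsAdditivePoly (φ.poly L a) := fun x y => by
  simp only [eval_poly, act_add]

theorem poly_mul (a b : Fq[X]) : φ.poly L (a * b) = (φ.poly L a).comp (φ.poly L b) := by
  rw [poly, φ.map_mul, Polynomial.map_comp]; rfl

theorem poly_comm (a b : Fq[X]) :
    (φ.poly L a).comp (φ.poly L b) = (φ.poly L b).comp (φ.poly L a) := by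
  rw [← poly_mul, mul_comm, poly_mul]

theorem poly_one : φ.poly L 1 = X := by rw [poly, φ.map_one, Polynomial.map_X]

theorem poly_add (a b : Fq[X]) : φ.poly L (a + b) = φ.poly L a + φ.poly L b := by
  rw [poly, φ.map_add, Polynomial.map_add]; rfl

theorem coeff_poly_one (a : Fq[X]) : (φ.poly L a).coeff 1 = algebraMap K L (i a) := by
  rw [poly, coeff_map, φ.coeff_one]

theorem coeff_poly_one_ne_zero (hi : Function.Injective i) {a : Fq[X]} (ha : a ≠ 0) :
    (φ.poly L a).coeff 1 ≠ 0 := by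
  rw [coeff_poly_one, _root_.map_ne_zero]
  exact fun h => ha (hi (by rw [h, map_zero]))

theorem poly_ne_zero (hi : Function.Injective i) {a : Fq[X]} (ha : a ≠ 0) : φ.poly L a ≠ 0 := by
  intro h
  have := φ.coeff_poly_one_ne_zero (L := L) hi ha
  rw [h] at this; simp at this

theorem act_add_left (a b : Fq[X]) (x : L) : φ.act (a + b) x = φ.act a x + φ.act b x := by
  rw [← eval_poly, ← eval_poly, ← eval_poly, poly_add, eval_add]

theorem act_zero_left (x : L) : φ.act 0 x = 0 := by
  have := φ.act_add_left 0 0 x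
  rw [add_zero] at this
  exact left_eq_add.1 this

theorem act_neg_left (a : Fq[X]) (x : L) : φ.act (-a) x = -φ.act a x := by
  rw [eq_neg_iff_add_eq_zero, ← act_add_left, neg_add_cancel, act_zero_left]

theorem act_sub_left (a b : Fq[X]) (x : L) : φ.act (a - b) x = φ.act a x - φ.act b x := by
  rw [sub_eq_add_neg, act_add_left, act_neg_left, sub_eq_add_neg]

theorem act_sum {σ : Type*} (a : Fq[X]) (s : Finset σ) (x : σ → L) :
    φ.act a (∑ j ∈ s, x j) = ∑ j ∈ s, φ.act a (x j) := map_sum (φ.actHom a) x s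

theorem act_sum_left {σ : Type*} (a : σ → Fq[X]) (s : Finset σ) (x : L) :
    φ.act (∑ j ∈ s, a j) x = ∑ j ∈ s, φ.act (a j) x :=
  map_sum (AddMonoidHom.mk' (fun a => φ.act a x) fun a b => φ.act_add_left a b x) a s

/-- Pigeonhole: A is infinite and F has finitely many self-maps, so two distinct elements of A act
alike on F, and their difference kills it. -/
theorem exists_act_eq_zero_of_finite {F : Set L} (hF : F.Finite)
    (hstable : ∀ a, ∀ x ∈ F, φ.act a x ∈ F) : ∃ c : Fq[X], c ≠ 0 ∧ ∀ x ∈ F, φ.act c x = 0 := by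
  have : Finite F := hF
  obtain ⟨a, b, hne, hab⟩ := Finite.exists_ne_map_eq_of_infinite
    (fun (a : Fq[X]) (x : F) => (⟨φ.act a x, hstable a x x.2⟩ : F))
  refine ⟨a - b, sub_ne_zero.2 hne, fun x hx => ?_⟩
  have := congrArg Subtype.val (congrFun hab ⟨x, hx⟩)
  rw [act_sub_left, sub_eq_zero]
  exact this

theorem exists_prime_charP (Fq K L : Type*) [Field Fq] [Fintype Fq] [Field K] [Algebra Fq K]
    [Field L] [Algebra K L] :
    ∃ p : ℕ, p.Prime ∧ CharP L p ∧ ∃ n : ℕ, Fintype.card Fq = p ^ n := by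
  obtain ⟨p, hp⟩ := CharP.exists Fq
  obtain ⟨n, hpp, hn⟩ := FiniteField.card Fq p
  exact ⟨p, hpp, charP_of_injective_ringHom
    ((algebraMap K L).comp (algebraMap Fq K)).injective p, n, hn⟩

end Poly

/-! ### Turning additive relations into relations over A -/

section Key

variable {L : Type*} [Field L] [IsAlgClosed L] [Algebra K L]

/-- Every additive polynomial over `L` commuting with `φ` is one of the `φ_b`. -/
def AdditiveEndEqA (φ : DrinfeldModule i) (L : Type*) [Field L] [Algebra K L] : Prop :=
  ∀ h : L[X], IsAdditivePoly h →
    (∀ a, h.comp (φ.poly L a) = (φ.poly L a).comp h) → ∃ b, h = φ.poly L b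

/-- Isogenies with the same source and target as the separable `f` differ from it by
endomorphisms. -/
theorem exists_comp_eq_poly (hi : Function.Injective i) (hE : φ.AdditiveEndEqA L)
    {σ : Type*} (f : σ → L[X]) (hf : ∀ j, IsAdditivePoly (f j)) (ψ : Fq[X] → L[X])
    (hψ : ∀ a j, (f j).comp (φ.poly L a) = (ψ a).comp (f j)) (hψ' : ∀ a, IsAdditivePoly (ψ a))
    (j₁ : σ) (h₁ : (f j₁).coeff 1 ≠ 0) :
    ∃ (u : L[X]) (b : σ → Fq[X]), IsAdditivePoly u ∧ b j₁ ≠ 0 ∧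
      ∀ j, u.comp (f j) = φ.poly L (b j) := by
  obtain ⟨p, hp, hchar, -⟩ := exists_prime_charP Fq K L
  have : Fact p.Prime := ⟨hp⟩
  have hinf : Infinite L := IsAlgClosed.instInfinite
  have hf0 : f j₁ ≠ 0 := by intro h; rw [h] at h₁; simp at h₁
  have hfin : {x | (f j₁).eval x = 0}.Finite := by
    classical
    refine (f j₁).roots.toFinset.finite_toSet.subset fun x hx => ?_
    simpa [mem_roots hf0] using hx
  -- The finite kernel of f_{j₁} is A-stable by the intertwining with ψ, so some φ_c kills it and
  -- factors as u ∘ f_{j₁}: u is a dual isogeny.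
  obtain ⟨c, hc0, hc⟩ := φ.exists_act_eq_zero_of_finite hfin fun a x hx => by
    have := congrArg (fun P => P.eval x) (hψ a j₁)
    simp only [eval_comp, eval_poly] at this
    have hx' : (f j₁).eval x = 0 := hx
    rw [hx', (hψ' a).eval_zero] at this
    exact this
  obtain ⟨u, hu, hcu⟩ := (hf j₁).exists_eq_comp p h₁ (φ.isAdditivePoly_poly c)
    (fun x hx => by rw [eval_poly]; exact hc x hx)
  have hu_comm : ∀ a, u.comp (ψ a) = (φ.poly L a).comp u := by
    intro a
    -- It suffices to compare after composing on the right with f_{j₁}, which is surjective.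
    refine Polynomial.funext fun y => ?_
    obtain ⟨x, rfl⟩ := (hf j₁).surjective hf0 y
    have h1 : (u.comp (ψ a)).comp (f j₁) = ((φ.poly L a).comp u).comp (f j₁) := by
      rw [comp_assoc, ← hψ, ← comp_assoc, ← hcu, poly_comm, comp_assoc, ← hcu]
    have := congrArg (fun P => P.eval x) h1
    simpa only [eval_comp] using this
  have hb : ∀ j, ∃ b, u.comp (f j) = φ.poly L b := by
    intro j
    refine hE _ (hu.comp (hf j)) fun a => ?_
    rw [comp_assoc, hψ, ← comp_assoc, hu_comm, comp_assoc]
  choose b hb using hb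
  refine ⟨u, b, hu, ?_, hb⟩
  intro h0
  have h2 := hb j₁
  rw [h0, ← hcu] at h2
  have h3 : φ.poly L 0 = 0 := by
    refine Polynomial.funext fun x => ?_
    rw [eval_poly, act_zero_left, Polynomial.eval_zero]
  exact φ.poly_ne_zero hi hc0 (h2.trans h3)

theorem exists_act_relation {σ : Type*} [Fintype σ] (hi : Function.Injective i)
    (hE : φ.AdditiveEndEqA L) (G : AddSubgroup (σ → L))
    (hstable : ∀ a, ∀ x ∈ G, (fun j => φ.act a (x j)) ∈ G)
    (hG : ∃ P : MvPolynomial σ L, P ≠ 0 ∧ ∀ x ∈ G, MvPolynomial.eval x P = 0) :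
    ∃ b : σ → Fq[X], b ≠ 0 ∧ ∀ x ∈ G, ∑ j, φ.act (b j) (x j) = 0 := by
  classical
  obtain ⟨p, hp, hchar, -⟩ := exists_prime_charP Fq K L
  have : Fact p.Prime := ⟨hp⟩
  have hinf : Infinite L := IsAlgClosed.instInfinite
  let Rel : (σ → L[X]) → Prop := fun f =>
    (∀ j, IsAdditivePoly (f j)) ∧ ∀ x ∈ G, ∑ j, (f j).eval (x j) = 0
  let supp : (σ → L[X]) → Finset σ := fun f => Finset.univ.filter fun j => f j ≠ 0
  have hsupp : ∀ f j, j ∈ supp f ↔ f j ≠ 0 := fun f j => by simp [supp]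
  -- Two minimizations: f₀ has minimal support among nonzero relations, then f has minimal degree at
  -- j₀ among nonzero relations supported in the support of f₀.
  obtain ⟨f₀, ⟨hf₀, hR₀⟩, hmin₀⟩ := WellFounded.has_min
    (measure fun f : σ → L[X] => (supp f).card).wf {f | f ≠ 0 ∧ Rel f} (by
      obtain ⟨f, h0, h1, h2⟩ := exists_additive_relation G hG
      exact ⟨f, h0, h1, h2⟩)
  obtain ⟨j₀, hj₀⟩ := Function.ne_iff.1 hf₀
  have hzero : ∀ g, Rel g → supp g ⊆ supp f₀ → g j₀ = 0 → g = 0 := by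
    intro g hg hsub hgj
    by_contra hne
    refine hmin₀ g ⟨hne, hg⟩ (Finset.card_lt_card ⟨hsub, fun h => ?_⟩)
    exact (hsupp g j₀).1 (h ((hsupp f₀ j₀).2 hj₀)) hgj
  obtain ⟨f, ⟨hf, ⟨hfa, hfr⟩, hfs⟩, hmin⟩ := WellFounded.has_min
    (measure fun f : σ → L[X] => (f j₀).natDegree).wf
    {f | f ≠ 0 ∧ Rel f ∧ supp f ⊆ supp f₀} ⟨f₀, hf₀, hR₀, subset_rfl⟩
  have hfj : f j₀ ≠ 0 := fun h => hf (hzero f ⟨hfa, hfr⟩ hfs h)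
  -- Otherwise every f_j is a p-th power, and extracting p-th roots gives a relation of smaller
  -- degree at j₀.
  have hlin : ∃ j₁, (f j₁).coeff 1 ≠ 0 := by
    by_contra! h
    choose g hga hgp using fun j => (hfa j).exists_pow_eq p (h j)
    refine hmin g ⟨?_, ⟨hga, fun x hx => ?_⟩, fun j hj => hfs ?_⟩ ?_
    · rintro rfl
      apply hfj
      rw [hgp]; simp [hp.ne_zero]
    · have h1 := hfr x hx
      simp only [hgp, eval_pow] at h1
      rw [← sum_pow_char] at h1
      exact pow_eq_zero_iff hp.ne_zero |>.1 h1
    · rw [hsupp] at hj ⊢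
      rw [hgp]; exact pow_ne_zero _ hj
    · change (g j₀).natDegree < (f j₀).natDegree
      have hg0 : g j₀ ≠ 0 := by
        intro h0; apply hfj; rw [hgp, h0]; simp [hp.ne_zero]
      rw [hgp j₀, natDegree_pow]
      have := (hga j₀).natDegree_pos hg0
      have := hp.one_lt
      nlinarith
  have hψ : ∀ a, ∃ ψ : L[X], IsAdditivePoly ψ ∧
      ∀ j, (f j).comp (φ.poly L a) = ψ.comp (f j) := by
    intro a
    have hadd := fun j => (hfa j).comp (φ.isAdditivePoly_poly (L := L) a)
    obtain ⟨ψ, hψ, hlt⟩ := (hfa j₀).exists_sub_comp_degree_lt p hfj (hadd j₀)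
    refine ⟨ψ, hψ, ?_⟩
    -- ψ is the quotient of f_{j₀} ∘ φ_a by f_{j₀}. The vector g is again a relation because G is
    -- φ-stable, and its degree at j₀ has dropped, so it is zero.
    let g : σ → L[X] := fun j => (f j).comp (φ.poly L a) - ψ.comp (f j)
    have hgr : Rel g := by
      refine ⟨fun j => (hadd j).sub (hψ.comp (hfa j)), fun x hx => ?_⟩
      simp only [g, eval_sub, eval_comp, eval_poly, Finset.sum_sub_distrib]
      rw [hfr _ (hstable a x hx), ← hψ.eval_sum, hfr x hx, hψ.eval_zero, sub_zero]
    have hgs : supp g ⊆ supp f₀ := by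
      intro j hj
      apply hfs
      rw [hsupp] at hj ⊢
      intro h0
      apply hj
      simp only [g, h0, zero_comp, comp_zero]
      rw [← coeff_zero_eq_eval_zero, hψ.coeff_zero, C_0, sub_zero]
    have hg : g = 0 := by
      by_contra hne
      have hgj : g j₀ ≠ 0 := fun h => hne (hzero g hgr hgs h)
      exact hmin g ⟨hne, hgr, hgs⟩ (natDegree_lt_natDegree hgj hlt)
    exact fun j => sub_eq_zero.1 (congrFun hg j)
  choose ψ hψ' hψ using hψ
  obtain ⟨j₁, hj₁⟩ := hlin
  obtain ⟨u, b, hu, hb, hub⟩ := φ.exists_comp_eq_poly hi hE f hfa ψ hψ hψ' j₁ hj₁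
  refine ⟨b, fun h => hb (by rw [h]; rfl), fun x hx => ?_⟩
  have : ∑ j, φ.act (b j) (x j) = u.eval (∑ j, (f j).eval (x j)) := by
    rw [hu.eval_sum]
    refine Finset.sum_congr rfl fun j _ => ?_
    rw [← eval_poly, ← hub, eval_comp]
  rw [this, hfr x hx, hu.eval_zero]

end Key
end DrinfeldModule
/-! ### Endomorphisms and torsion over the separable closure -/

namespace DrinfeldModule

variable {Fq : Type*} [Field Fq] [Fintype Fq] {K : Type*} [Field K] [Algebra Fq K]
  {i : Fq[X] →ₐ[Fq] K} (φ : DrinfeldModule i)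

theorem coeff_zero (a : Fq[X]) : (φ.toFun a).coeff 0 = 0 := by
  rw [coeff_zero_eq_eval_zero, ← coe_aeval_eq_eval]
  exact φ.act_zero (L := K) a

theorem eq_of_natDegree_le_one {a : Fq[X]} (h : (φ.toFun a).natDegree ≤ 1) :
    φ.toFun a = C (i a) * X := by
  rw [eq_X_add_C_of_natDegree_le_one h, φ.coeff_zero, φ.coeff_one]
  simp

theorem natDegree_comp_mul (a b : Fq[X]) :
    (φ.toFun (a * b)).natDegree = (φ.toFun a).natDegree * (φ.toFun b).natDegree := by
  rw [φ.map_mul, natDegree_comp]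

/-- A nonzero constant is a unit of A and degrees multiply under composition, so its image has
degree 1. -/
theorem toFun_C (c : Fq) : φ.toFun (C c) = C (algebraMap Fq K c) * X := by
  have h : (φ.toFun (C c)).natDegree ≤ 1 := by
    by_cases hc : c = 0
    · have h0 : φ.toFun 0 = 0 := by
        have := φ.map_add 0 0
        rw [add_zero] at this
        exact left_eq_add.1 this
      rw [hc, C_0, h0]; simp
    · have h1 := φ.natDegree_comp_mul (C c) (C c⁻¹)
      rw [← C_mul, mul_inv_cancel₀ hc, C_1, φ.map_one, natDegree_X] at h1
      exact (Nat.eq_one_of_mul_eq_one_right h1.symm).le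
  rw [φ.eq_of_natDegree_le_one h]
  congr 2
  exact AlgHom.commutes i c

/-- If φ_t were linear, then so would be every φ_a. The bound yields nonzero t-torsion and makes the
limits defining canonical heights converge. -/
theorem one_lt_natDegree : 1 < (φ.toFun X).natDegree := by
  by_contra! h
  obtain ⟨a, ha⟩ := φ.nontrivial
  refine ha (φ.eq_of_natDegree_le_one ?_)
  induction a using Polynomial.induction_on' with
  | add p q hp hq =>
    by_cases h1 : φ.toFun p = C (i p) * X
    · by_cases h2 : φ.toFun q = C (i q) * X
      · refine absurd ?_ ha
        rw [φ.map_add, h1, h2, _root_.map_add, C_add, add_mul]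
      · rw [φ.map_add]
        refine (natDegree_add_le _ _).trans (max_le ?_ (hq h2))
        rw [h1]; exact (natDegree_C_mul_le _ _).trans natDegree_X_le
    · rw [φ.map_add]
      refine (natDegree_add_le _ _).trans (max_le (hp h1) ?_)
      by_cases h2 : φ.toFun q = C (i q) * X
      · rw [h2]; exact (natDegree_C_mul_le _ _).trans natDegree_X_le
      · exact hq h2
  | monomial n c =>
    rw [← C_mul_X_pow_eq_monomial, φ.natDegree_comp_mul]
    have h1 : (φ.toFun (C c)).natDegree ≤ 1 := by
      rw [φ.toFun_C]; exact (natDegree_C_mul_le _ _).trans natDegree_X_le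
    have h2 : (φ.toFun (X ^ n)).natDegree ≤ 1 := by
      clear ha
      induction n with
      | zero => rw [pow_zero, φ.map_one, natDegree_X]
      | succ n ih =>
        rw [pow_succ, φ.natDegree_comp_mul]
        exact (Nat.mul_le_mul ih h).trans (by norm_num)
    exact (Nat.mul_le_mul h1 h2).trans (by norm_num)

theorem separable_toFun (hi : Function.Injective i) {c : Fq[X]} (hc : c ≠ 0) :
    (φ.toFun c).Separable :=
  (separable_map (algebraMap K (AlgebraicClosure K))).1
    ((φ.isAdditivePoly_poly c).separable (φ.coeff_poly_one_ne_zero hi hc))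

/-- In generic characteristic φ_c has nonzero linear coefficient i(c), hence is separable. -/
theorem mem_separableClosure {Ω : Type*} [Field Ω] [Algebra K Ω] (hi : Function.Injective i) {c : Fq[X]} (hc : c ≠ 0) {x : Ω}
    (hx : φ.act c x = 0) : x ∈ separableClosure K Ω := by
  rw [mem_separableClosure_iff]
  exact (φ.separable_toFun hi hc).of_dvd (minpoly.dvd K x hx)

/-- Commuting with the scalars c ∈ 𝔽_q forces c^(p^k) = c for every exponent p^k that occurs. So
X^(p^(k mod e)) - X has q roots, which is too many unless e divides k. -/
theorem isTauPolynomial_of_comm {L : Type*} [Field L] [Algebra K L] {h : L[X]}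
    {p : ℕ} (hp : 1 < p) {e : ℕ} (he : Fintype.card Fq = p ^ e)
    (hpow : ∀ n, h.coeff n ≠ 0 → ∃ m, n = p ^ m)
    (hcomm : ∀ a, h.comp (φ.poly L a) = (φ.poly L a).comp h) :
    IsTauPolynomial (Fintype.card Fq) h := by
  intro n hn
  obtain ⟨k, rfl⟩ := hpow n hn
  have hroot : ∀ c : Fq, c ^ p ^ k = c := by
    intro c
    have h1 := congrArg (fun P => P.coeff (p ^ k)) (hcomm (C c))
    have h2 : φ.poly L (C c) = C (algebraMap K L (algebraMap Fq K c)) * X := by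
      rw [poly, φ.toFun_C]; simp
    simp only [h2, comp_C_mul_X_coeff, mul_comp, C_comp, X_comp, coeff_C_mul] at h1
    rw [mul_comm] at h1
    have h3 := mul_right_cancel₀ hn h1
    rw [← _root_.map_pow, ← _root_.map_pow] at h3
    exact (algebraMap Fq K).injective ((algebraMap K L).injective h3)
  have hroot' : ∀ c : Fq, c ^ p ^ (k % e) = c := by
    intro c
    have h1 := hroot c
    rw [← Nat.div_add_mod k e, pow_add, pow_mul, pow_mul, ← he, FiniteField.pow_card_pow] at h1
    exact h1
  have he0 : 0 < e := by
    rcases Nat.eq_zero_or_pos e with h0 | h0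
    · have := Fintype.one_lt_card (α := Fq)
      rw [he, h0] at this; simp at this
    · exact h0
  have hmod : k % e = 0 := by
    by_contra h0
    have hlt : 1 < p ^ (k % e) := Nat.one_lt_pow h0 hp
    have hnd : (X ^ p ^ (k % e) - X : Fq[X]).natDegree = p ^ (k % e) :=
      FiniteField.X_pow_card_sub_X_natDegree_eq Fq hlt
    have hz : (X ^ p ^ (k % e) - X : Fq[X]) = 0 := by
      refine eq_zero_of_natDegree_lt_card_of_eval_eq_zero' _ Finset.univ (fun c _ => ?_) ?_
      · simp [hroot' c]
      · rw [hnd, Finset.card_univ, he]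
        exact Nat.pow_lt_pow_right hp (Nat.mod_lt _ he0)
    rw [hz, natDegree_zero] at hnd
    omega
  refine ⟨k / e, ?_⟩
  rw [he, ← pow_mul]
  congr 1
  have := Nat.div_add_mod k e
  omega

/-- Division of additive polynomials takes place over the algebraically closed Ω, while `EndEqA`
speaks of K^sep and of polynomials in τ. An endomorphism over Ω is descended through its roots and
its leading coefficient. -/
theorem additiveEndEqA {Ω : Type*} [Field Ω] [IsAlgClosed Ω] [Algebra K Ω] (hi : Function.Injective i)
    (hE : φ.EndEqA (separableClosure K Ω)) :
    φ.AdditiveEndEqA Ω := by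
  obtain ⟨p, hp, hchar, e, he⟩ := exists_prime_charP Fq K Ω
  have : Fact p.Prime := ⟨hp⟩
  have hinf : Infinite Ω := IsAlgClosed.instInfinite
  -- Adding the identity, which is φ_1, makes the linear coefficient nonzero.
  suffices H : ∀ h : Polynomial Ω, IsAdditivePoly h → h.coeff 1 ≠ 0 →
      (∀ a, h.comp (φ.poly Ω a) = (φ.poly Ω a).comp h) → ∃ b, h = φ.poly Ω b by
    intro h hh hcomm
    by_cases h1 : h.coeff 1 = 0
    · obtain ⟨b, hb⟩ := H (h + X) (hh.add .X) (by simp [h1]) fun a => by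
        rw [add_comp, X_comp, hcomm, (φ.isAdditivePoly_poly a).comp_add, comp_X]
      refine ⟨b - 1, ?_⟩
      rw [eq_sub_of_add_eq hb, sub_eq_iff_eq_add]
      rw [← φ.poly_one (L := Ω)]
      rw [← poly_add, sub_add_cancel]
    · exact H h hh h1 hcomm
  intro h hh h1 hcomm
  have h0 : h ≠ 0 := by rintro rfl; simp at h1
  have hroots : ∀ x ∈ h.roots, x ∈ separableClosure K Ω := by
    have hfin : {x | h.eval x = 0}.Finite := by
      classical
      refine h.roots.toFinset.finite_toSet.subset fun x hx => ?_
      simpa [mem_roots h0] using hx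
    obtain ⟨c, hc0, hc⟩ := φ.exists_act_eq_zero_of_finite hfin fun a x hx => by
      have := congrArg (fun P => P.eval x) (hcomm a)
      simp only [eval_comp, eval_poly] at this
      have hx' : h.eval x = 0 := hx
      rw [hx', φ.act_zero] at this
      exact this
    exact fun x hx => φ.mem_separableClosure hi hc0 (hc x ((mem_roots h0).1 hx))
  -- Comparing leading coefficients in h ∘ φ_t = φ_t ∘ h puts the (d - 1)-th power of that of h in
  -- K, where d = deg φ_t. As d is a positive power of p, d - 1 is prime to p, and the root is
  -- separable.
  have hlead : h.leadingCoeff ∈ separableClosure K Ω := by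
    set g := φ.poly Ω X with hg
    have hgK : g.leadingCoeff = algebraMap K Ω (φ.toFun X).leadingCoeff := leadingCoeff_map _
    have hgd : 1 < g.natDegree := by
      rw [hg, poly, natDegree_map]; exact φ.one_lt_natDegree
    have hg0 : g ≠ 0 := by rintro h; rw [h] at hgd; simp at hgd
    have hhd := hh.natDegree_pos h0
    have hl := congrArg leadingCoeff (hcomm X)
    rw [← hg, leadingCoeff_comp (by omega), leadingCoeff_comp (by omega)] at hl
    have hlc : h.leadingCoeff ≠ 0 := leadingCoeff_ne_zero.2 h0
    have hgc : g.leadingCoeff ≠ 0 := leadingCoeff_ne_zero.2 hg0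
    have hpow : h.leadingCoeff ^ (g.natDegree - 1)
        = algebraMap K Ω ((φ.toFun X).leadingCoeff ^ (h.natDegree - 1)) := by
      rw [_root_.map_pow, ← hgK]
      refine mul_left_cancel₀ (mul_ne_zero hlc hgc) ?_
      calc _ = g.leadingCoeff * (h.leadingCoeff ^ (g.natDegree - 1) * h.leadingCoeff) := by ring
        _ = g.leadingCoeff * h.leadingCoeff ^ g.natDegree := by
          rw [← pow_succ, Nat.sub_add_cancel hgd.le]
        _ = h.leadingCoeff * (g.leadingCoeff ^ (h.natDegree - 1) * g.leadingCoeff) := by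
          rw [← hl, ← pow_succ, Nat.sub_add_cancel hhd]
        _ = _ := by ring
    obtain ⟨m, hm⟩ := (φ.isAdditivePoly_poly X).exists_eq_pow p (n := g.natDegree)
      (leadingCoeff_ne_zero.2 hg0)
    have hm0 : m ≠ 0 := by rintro rfl; rw [hm] at hgd; simp at hgd
    have hchK : CharP K p := (algebraMap K Ω).charP (algebraMap K Ω).injective p
    have hcast : ((g.natDegree - 1 : ℕ) : K) ≠ 0 := by
      rw [Nat.cast_sub hgd.le, hm]
      simp [hm0]
    rw [mem_separableClosure_iff]
    refine (separable_X_pow_sub_C ((φ.toFun X).leadingCoeff ^ (h.natDegree - 1)) hcast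
      (pow_ne_zero _ ?_)).of_dvd (minpoly.dvd K _ ?_)
    · rw [leadingCoeff_ne_zero]; intro h; have := φ.one_lt_natDegree; rw [h] at this; simp at this
    · simp only [_root_.map_sub, _root_.map_pow, aeval_X, aeval_C]
      rw [hpow, _root_.map_pow, sub_self]
  have hlift : h ∈ lifts (algebraMap (separableClosure K Ω) Ω) := by
    rw [(IsAlgClosed.splits h).eq_prod_roots]
    refine mul_mem (C_mem_lifts _ (⟨_, hlead⟩ : separableClosure K Ω)) ?_
    refine multiset_prod_mem _ fun P hP => ?_
    obtain ⟨x, hx, rfl⟩ := Multiset.mem_map.1 hP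
    exact ⟨X - C ⟨x, hroots x hx⟩, by simp⟩
  obtain ⟨f, hf⟩ := hlift
  have hf' : f.map (algebraMap (separableClosure K Ω) Ω) = h := hf
  have hmap : ∀ a, (φ.poly (separableClosure K Ω) a).map (algebraMap (separableClosure K Ω) Ω)
      = φ.poly Ω a := fun a => by
    rw [poly, poly, Polynomial.map_map, ← IsScalarTower.algebraMap_eq]
  have hinj := Polynomial.map_injective (algebraMap (separableClosure K Ω) Ω)
    (algebraMap (separableClosure K Ω) Ω).injective
  have hfcomm : ∀ a, f.comp (φ.poly (separableClosure K Ω) a)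
      = (φ.poly (separableClosure K Ω) a).comp f := fun a => hinj (by
    rw [Polynomial.map_comp, Polynomial.map_comp, hmap, hf', hcomm])
  obtain ⟨b, hb⟩ := hE f (φ.isTauPolynomial_of_comm hp.one_lt he (fun n hn =>
    hh.exists_eq_pow p (by rw [← hf', coeff_map, _root_.map_ne_zero]; exact hn)) hfcomm) hfcomm
  exact ⟨b, by rw [← hmap, ← hf', hb]; rfl⟩

end DrinfeldModule
/-! ### The Zariski topology on affine space -/

section Zariski

variable {K : Type*} [Field K] {Ω : Type*} [Field Ω] [Algebra K Ω] {m n : ℕ}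

/-- A map of affine spaces given by polynomials over `K^sep`. -/
def IsPolynomialMap (K : Type*) [Field K] {Ω : Type*} [Field Ω] [Algebra K Ω] {m n : ℕ}
    (F : (Fin n → Ω) → Fin m → Ω) : Prop :=
  ∃ P : Fin m → MvPolynomial (Fin n) (separableClosure K Ω),
    ∀ x j, F x j = MvPolynomial.aeval x (P j)

theorem IsPolynomialMap.exists_comap {F : (Fin n → Ω) → Fin m → Ω} (hF : IsPolynomialMap K F) :
    ∃ f : MvPolynomial (Fin m) (separableClosure K Ω) →ₐ[separableClosure K Ω]
      MvPolynomial (Fin n) (separableClosure K Ω),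
      ∀ Q x, MvPolynomial.aeval x (f Q) = MvPolynomial.aeval (F x) Q := by
  obtain ⟨P, hP⟩ := hF
  refine ⟨MvPolynomial.aeval P, fun Q x => ?_⟩
  have : (fun j => F x j) = fun j => MvPolynomial.aeval x (P j) := funext (hP x)
  change _ = MvPolynomial.aeval (fun j => F x j) Q
  rw [this]
  induction Q using MvPolynomial.induction_on with
  | C a => simp
  | add P Q hP hQ => simp only [map_add, hP, hQ]
  | mul_X P j hP => simp only [map_mul, hP, MvPolynomial.aeval_X]

theorem IsSubvariety.preimage {F : (Fin n → Ω) → Fin m → Ω} (hF : IsPolynomialMap K F)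
    {V : Set (Fin m → Ω)} (hV : IsSubvariety K V) : IsSubvariety K (F ⁻¹' V) := by
  obtain ⟨f, hf⟩ := hF.exists_comap
  obtain ⟨I, rfl⟩ := hV
  refine ⟨Ideal.span (f '' I), ?_⟩
  ext x
  rw [MvPolynomial.zeroLocus_span]
  simp only [Set.mem_preimage, MvPolynomial.mem_zeroLocus_iff, Set.mem_ofPred_eq,
    Set.forall_mem_image, hf]
  rfl

theorem IsIrred.image {F : (Fin n → Ω) → Fin m → Ω} (hF : IsPolynomialMap K F)
    {V : Set (Fin n → Ω)} (hV : IsIrred K V) : IsIrred K (F '' V) := by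
  obtain ⟨f, hf⟩ := hF.exists_comap
  have : MvPolynomial.vanishingIdeal (separableClosure K Ω) (F '' V)
      = (MvPolynomial.vanishingIdeal (separableClosure K Ω) V).comap f := by
    ext Q
    simp only [MvPolynomial.mem_vanishingIdeal_iff, Ideal.mem_comap, Set.forall_mem_image, hf]
  unfold IsIrred at hV ⊢
  rw [this]
  exact Ideal.comap_isPrime f _

theorem IsSubvariety.zeroLocus_vanishingIdeal {V : Set (Fin n → Ω)} (hV : IsSubvariety K V) :
    MvPolynomial.zeroLocus Ω (MvPolynomial.vanishingIdeal (separableClosure K Ω) V) = V := by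
  obtain ⟨I, rfl⟩ := hV
  exact (MvPolynomial.zeroLocus_anti_mono
    (MvPolynomial.le_vanishingIdeal_zeroLocus I)).antisymm
      (MvPolynomial.zeroLocus_vanishingIdeal_le _)

/-- A `K^sep`-subvariety containing `S` contains the Zariski closure of `S`. -/
theorem zeroLocus_vanishingIdeal_subset {S V : Set (Fin n → Ω)} (hV : IsSubvariety K V)
    (h : S ⊆ V) :
    MvPolynomial.zeroLocus Ω (MvPolynomial.vanishingIdeal (separableClosure K Ω) S) ⊆ V := by
  rw [← hV.zeroLocus_vanishingIdeal]
  exact MvPolynomial.zeroLocus_anti_mono (MvPolynomial.vanishingIdeal_anti_mono h)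

theorem exists_polynomial_of_ne_univ {V : Set (Fin n → Ω)} (hV : IsSubvariety K V)
    (hne : V ≠ Set.univ) : ∃ P : MvPolynomial (Fin n) (separableClosure K Ω), P ≠ 0 ∧
      ∀ x ∈ V, MvPolynomial.aeval x P = 0 := by
  obtain ⟨I, rfl⟩ := hV
  by_contra! h
  refine hne ?_
  have : I = ⊥ := by
    rw [eq_bot_iff]
    intro P hP
    by_contra h0
    obtain ⟨x, hx, hx'⟩ := h P h0
    exact hx' (hx P hP)
  rw [this, MvPolynomial.zeroLocus_bot]; rfl

theorem isIrred_univ [Infinite Ω] : IsIrred K (Set.univ : Set (Fin n → Ω)) := by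
  have : MvPolynomial.vanishingIdeal (separableClosure K Ω) (Set.univ : Set (Fin n → Ω)) = ⊥ := by
    rw [eq_bot_iff]
    intro P hP
    have hmap : MvPolynomial.map (algebraMap (separableClosure K Ω) Ω) P = 0 := by
      refine MvPolynomial.funext fun x => ?_
      have := hP x trivial
      rw [MvPolynomial.eval_map, map_zero]
      exact this
    exact MvPolynomial.map_injective _ (algebraMap (separableClosure K Ω) Ω).injective
      (by rw [hmap, map_zero])
  unfold IsIrred
  rw [this]
  exact Ideal.isPrime_bot

/-- An irreducible set contained in a finite union of closed sets is contained in one of them. -/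
theorem IsIrred.subset_of_subset_biUnion {V : Set (Fin n → Ω)} (hV : IsIrred K V) {ι : Type*}
    (s : Finset ι) (T : ι → Set (Fin n → Ω)) (hT : ∀ j ∈ s, IsSubvariety K (T j))
    (h : V ⊆ ⋃ j ∈ s, T j) : ∃ j ∈ s, V ⊆ T j := by
  classical
  by_contra! hne
  have hP : ∀ j : s, ∃ P : MvPolynomial (Fin n) (separableClosure K Ω),
      (∀ x ∈ T j, MvPolynomial.aeval x P = 0) ∧ ∃ x ∈ V, MvPolynomial.aeval x P ≠ 0 := by
    rintro ⟨j, hj⟩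
    obtain ⟨I, hI⟩ := hT j hj
    obtain ⟨x, hxV, hxT⟩ := Set.not_subset.1 (hne j hj)
    rw [hI, MvPolynomial.mem_zeroLocus_iff] at hxT
    push Not at hxT
    obtain ⟨P, hP, hPx⟩ := hxT
    exact ⟨P, fun y hy => by rw [hI] at hy; exact hy P hP, x, hxV, hPx⟩
  choose P hP1 hP2 using hP
  have hprod : ∏ j ∈ s.attach, P j ∈ MvPolynomial.vanishingIdeal (separableClosure K Ω) V := by
    intro x hx
    obtain ⟨j, hj, hxj⟩ := Set.mem_iUnion₂.1 (h hx)
    rw [map_prod]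
    exact Finset.prod_eq_zero (Finset.mem_attach s ⟨j, hj⟩) (hP1 ⟨j, hj⟩ x hxj)
  have := hV
  unfold IsIrred at this
  obtain ⟨j, -, hj⟩ := (Ideal.IsPrime.prod_mem_iff).1 hprod
  obtain ⟨x, hx, hne⟩ := hP2 j
  exact hne (hj x hx)

end Zariski

/-! ### Matrices over `A` acting on affine space -/

namespace DrinfeldModule

variable {Fq : Type*} [Field Fq] [Fintype Fq] {K : Type*} [Field K] [Algebra Fq K]
  {i : Fq[X] →ₐ[Fq] K} (φ : DrinfeldModule i)

section MatAct

variable {L : Type*} [Field L] [Algebra K L] {l m n : ℕ}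

/-- The action of a matrix over `A` through `φ`. -/
noncomputable def matAct (B : Matrix (Fin m) (Fin n) Fq[X]) (x : Fin n → L) : Fin m → L :=
  fun j => ∑ k, φ.act (B j k) (x k)

theorem matAct_mul (B : Matrix (Fin l) (Fin m) Fq[X]) (C : Matrix (Fin m) (Fin n) Fq[X])
    (x : Fin n → L) : φ.matAct (B * C) x = φ.matAct B (φ.matAct C x) := by
  funext j
  simp only [matAct, Matrix.mul_apply, act_sum, act_sum_left, act_mul]
  exact Finset.sum_comm

theorem matAct_one (x : Fin n → L) : φ.matAct 1 x = x := by
  funext j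
  rw [matAct, Finset.sum_eq_single j]
  · rw [Matrix.one_apply_eq, act_one]
  · intro k _ hk; rw [Matrix.one_apply_ne hk.symm, act_zero_left]
  · simp

theorem matAct_add (B : Matrix (Fin m) (Fin n) Fq[X]) (x y : Fin n → L) :
    φ.matAct B (x + y) = φ.matAct B x + φ.matAct B y := by
  funext j
  simp only [matAct, Pi.add_apply, act_add, Finset.sum_add_distrib]

theorem matAct_zero (B : Matrix (Fin m) (Fin n) Fq[X]) : φ.matAct B (0 : Fin n → L) = 0 := by
  funext j
  simp [matAct, act_zero]

theorem matAct_act (B : Matrix (Fin m) (Fin n) Fq[X]) (a : Fq[X]) (x : Fin n → L) :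
    φ.matAct B (fun k => φ.act a (x k)) = fun j => φ.act a (φ.matAct B x j) := by
  funext j
  simp only [matAct, act_sum, ← act_mul, mul_comm]

theorem algebraMap_act {L' : Type*} [Field L'] [Algebra K L'] (f : L →ₐ[K] L') (a : Fq[X])
    (x : L) : f (φ.act a x) = φ.act a (f x) := by
  rw [act, act, aeval_algHom_apply]

theorem algebraMap_matAct {L' : Type*} [Field L'] [Algebra K L'] (f : L →ₐ[K] L')
    (B : Matrix (Fin m) (Fin n) Fq[X]) (x : Fin n → L) (j : Fin m) :
    f (φ.matAct B x j) = φ.matAct B (fun k => f (x k)) j := by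
  simp only [matAct, map_sum, algebraMap_act]

theorem aeval_aeval_X (a : Fq[X]) (x : Fin n → L) (k : Fin n) {k₀ : Type*} [Field k₀]
    [Algebra K k₀] [Algebra k₀ L] [IsScalarTower K k₀ L] :
    MvPolynomial.aeval x (Polynomial.aeval (MvPolynomial.X k : MvPolynomial (Fin n) k₀)
      (φ.toFun a)) = φ.act a (x k) := by
  have := Polynomial.aeval_algHom_apply
    ((MvPolynomial.aeval (R := k₀) x).restrictScalars K) (MvPolynomial.X k) (φ.toFun a)
  rw [AlgHom.restrictScalars_apply, MvPolynomial.aeval_X, AlgHom.restrictScalars_apply] at this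
  rw [← this, act]

end MatAct

/-! ### Matrix maps as polynomial maps, and torsion points -/

section Torsion

variable {Ω : Type*} [Field Ω] [Algebra K Ω] {m n N : ℕ}

theorem isPolynomialMap_matAct (B : Matrix (Fin m) (Fin n) Fq[X]) :
    IsPolynomialMap K (φ.matAct (L := Ω) B) :=
  ⟨fun j => ∑ k, Polynomial.aeval (MvPolynomial.X k) (φ.toFun (B j k)), fun x j => by
    simp only [map_sum, aeval_aeval_X, matAct]⟩

theorem isPolynomialMap_add {F : (Fin n → Ω) → Fin m → Ω} (hF : IsPolynomialMap K F)
    (α : Fin m → Ω) (hα : ∀ j, α j ∈ separableClosure K Ω) :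
    IsPolynomialMap K fun x => α + F x := by
  obtain ⟨P, hP⟩ := hF
  refine ⟨fun j => MvPolynomial.C ⟨α j, hα j⟩ + P j, fun x j => ?_⟩
  simp only [Pi.add_apply, _root_.map_add, MvPolynomial.aeval_C, hP]
  rfl

theorem isPolynomialMap_comp_add {F : (Fin n → Ω) → Fin m → Ω} (hF : IsPolynomialMap K F)
    (α : Fin n → Ω) (hα : ∀ j, α j ∈ separableClosure K Ω) :
    IsPolynomialMap K fun x => F (α + x) := by
  obtain ⟨P, hP⟩ := hF
  obtain ⟨g, hg⟩ := (isPolynomialMap_add (m := n) (n := n) (F := fun x => x)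
    ⟨fun j => MvPolynomial.X j, fun x j => by simp⟩ α hα).exists_comap
  exact ⟨fun j => g (P j), fun x j => (hP _ j).trans (hg _ _).symm⟩

theorem isTorsionPoint_mem (hi : Function.Injective i) {α : Fin N → Ω}
    (hα : IsTorsionPoint φ α) (j : Fin N) : α j ∈ separableClosure K Ω := by
  obtain ⟨a, ha, h⟩ := hα
  exact φ.mem_separableClosure hi ha (h j)

theorem isTorsionPoint_of_forall {α : Fin N → Ω} (h : ∀ j, α j ∈ φ.torsion Ω) :
    IsTorsionPoint φ α := by
  classical
  choose a ha hx using h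
  refine ⟨∏ j, a j, Finset.prod_ne_zero_iff.2 fun j _ => ha j, fun j => ?_⟩
  rw [← Finset.prod_erase_mul _ _ (Finset.mem_univ j), act_mul, hx, act_zero]

theorem isTorsionPoint_apply {α : Fin N → Ω} (h : IsTorsionPoint φ α) (j : Fin N) :
    α j ∈ φ.torsion Ω := by
  obtain ⟨a, ha, h⟩ := h
  exact ⟨a, ha, h j⟩

theorem isTorsionPoint_add {α β : Fin N → Ω} (hα : IsTorsionPoint φ α)
    (hβ : IsTorsionPoint φ β) : IsTorsionPoint φ (α + β) :=
  φ.isTorsionPoint_of_forall fun j =>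
    add_mem (φ.isTorsionPoint_apply hα j) (φ.isTorsionPoint_apply hβ j)

theorem isTorsionPoint_matAct (B : Matrix (Fin m) (Fin n) Fq[X]) {α : Fin n → Ω}
    (hα : IsTorsionPoint φ α) : IsTorsionPoint φ (φ.matAct B α) := by
  obtain ⟨a, ha, h⟩ := hα
  refine ⟨a, ha, fun j => ?_⟩
  rw [← congrFun (φ.matAct_act B a α) j]
  have : (fun k => φ.act a (α k)) = 0 := funext h
  rw [this, matAct_zero]; rfl

end Torsion
end DrinfeldModule
/-! ### The structure of irreducible algebraic `φ`-submodules -/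

theorem le_of_matrix_mul_eq_one {R : Type*} [CommRing R] [Nontrivial R] {g N : ℕ}
    {B : Matrix (Fin N) (Fin g) R} {C : Matrix (Fin g) (Fin N) R} (hCB : C * B = 1) : g ≤ N := by
  have hinj : Function.Injective (Matrix.toLin' B) := by
    intro x y hxy
    have := congrArg (Matrix.toLin' C) hxy
    simpa [Matrix.toLin'_apply, Matrix.mulVec_mulVec, hCB] using this
  simpa only [Fintype.card_fin] using card_le_of_injective R _ hinj

namespace DrinfeldModule

variable {Fq : Type*} [Field Fq] [Fintype Fq] {K : Type*} [Field K] [Algebra Fq K]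
  {i : Fq[X] →ₐ[Fq] K} (φ : DrinfeldModule i) {Ω : Type*} [Field Ω] [Algebra K Ω] {N : ℕ}

/-- The vectors of coefficients of the relations over `A` satisfied by the points of `W`. -/
def relations (W : Set (Fin N → Ω)) : Submodule Fq[X] (Fin N → Fq[X]) where
  carrier := {a | ∀ x ∈ W, ∑ j, φ.act (a j) (x j) = 0}
  zero_mem' x _ := by simp [act_zero_left]
  add_mem' {a b} ha hb x hx := by
    simp only [Pi.add_apply, act_add_left, Finset.sum_add_distrib, ha x hx, hb x hx, add_zero]
  smul_mem' c a ha x hx := by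
    simp only [Pi.smul_apply, smul_eq_mul, act_mul, ← act_sum, ha x hx, act_zero]

/-- On W the form ∑ a_j x_j takes values in the finite b-torsion; by irreducibility it is constant,
and at 0 it vanishes. This is why the quotient of A^N by the relations is torsion-free. -/
theorem mem_relations_of_smul_mem (hi : Function.Injective i) {W : Set (Fin N → Ω)}
    (h0 : 0 ∈ W) (hW : IsIrred K W) {b : Fq[X]} (hb : b ≠ 0) {a : Fin N → Fq[X]}
    (h : b • a ∈ φ.relations W) : a ∈ φ.relations W := by
  classical
  have hfin := φ.finite_ker (L := separableClosure K Ω) hi b hb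
  let lam : MvPolynomial (Fin N) (separableClosure K Ω) :=
    ∑ j, Polynomial.aeval (MvPolynomial.X j) (φ.toFun (a j))
  have hlam : ∀ x : Fin N → Ω, MvPolynomial.aeval x lam = ∑ j, φ.act (a j) (x j) := fun x => by
    simp only [lam, map_sum, aeval_aeval_X]
  have hprod : ∏ κ ∈ hfin.toFinset, (lam - MvPolynomial.C κ)
      ∈ MvPolynomial.vanishingIdeal (separableClosure K Ω) W := by
    intro x hx
    have h1 : φ.act b (MvPolynomial.aeval x lam) = 0 := by
      have := h x hx
      simp only [Pi.smul_apply, smul_eq_mul, act_mul, ← act_sum] at this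
      rw [hlam, this]
    have h2 := φ.mem_separableClosure hi hb h1
    rw [map_prod]
    refine Finset.prod_eq_zero (i := ⟨_, h2⟩) ?_ ?_
    · rw [Set.Finite.mem_toFinset, Set.mem_ofPred_eq]
      apply (algebraMap (separableClosure K Ω) Ω).injective
      have h3 := φ.algebraMap_act (IsScalarTower.toAlgHom K (separableClosure K Ω) Ω) b ⟨_, h2⟩
      rw [map_zero]
      exact h3.trans h1
    · rw [_root_.map_sub, MvPolynomial.aeval_C, sub_eq_zero]; rfl
  unfold IsIrred at hW
  obtain ⟨κ, -, hκ⟩ := (Ideal.IsPrime.prod_mem_iff).1 hprod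
  have hval : ∀ x ∈ W, ∑ j, φ.act (a j) (x j) = algebraMap _ Ω κ := fun x hx => by
    have := hκ x hx
    rwa [_root_.map_sub, MvPolynomial.aeval_C, sub_eq_zero, hlam] at this
  intro x hx
  rw [hval x hx, ← hval 0 h0]
  simp [act_zero]

/-- The image of B is the fixed locus of the idempotent BC, hence closed. -/
theorem isAlgebraicSubmodule_range {g : ℕ} {B : Matrix (Fin N) (Fin g) Fq[X]}
    {C : Matrix (Fin g) (Fin N) Fq[X]} (hCB : C * B = 1) :
    IsAlgebraicSubmodule φ (Set.range (φ.matAct (L := Ω) B)) where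
  isSubvariety := by
    refine ⟨Ideal.span (Set.range fun j => (∑ k, Polynomial.aeval (MvPolynomial.X k)
      (φ.toFun ((B * C) j k))) - MvPolynomial.X j), ?_⟩
    have hzero : ∀ (x : Fin N → Ω) j, MvPolynomial.aeval x ((∑ k, Polynomial.aeval
        (MvPolynomial.X k : MvPolynomial (Fin N) (separableClosure K Ω)) (φ.toFun ((B * C) j k)))
          - MvPolynomial.X j) = φ.matAct (B * C) x j - x j := fun x j => by
      simp only [_root_.map_sub, map_sum, aeval_aeval_X, MvPolynomial.aeval_X, matAct]
    ext x
    rw [MvPolynomial.zeroLocus_span, Set.mem_ofPred_eq, Set.forall_mem_range]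
    simp only [hzero, sub_eq_zero]
    constructor
    · rintro ⟨y, rfl⟩ j
      rw [← matAct_mul, Matrix.mul_assoc, hCB, Matrix.mul_one]
    · intro h
      exact ⟨φ.matAct C x, by rw [← matAct_mul]; exact _root_.funext h⟩
  zero_mem := ⟨0, φ.matAct_zero B⟩
  add_mem := by
    rintro _ ⟨x, rfl⟩ _ ⟨y, rfl⟩
    exact ⟨x + y, φ.matAct_add B x y⟩
  act_mem := by
    rintro a _ ⟨x, rfl⟩
    exact ⟨_, φ.matAct_act B a x⟩

/-- The translate by `α` of the image of `𝔾_a^g` under the matrix `B`. -/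
def affineImage {g : ℕ} (α : Fin N → Ω) (B : Matrix (Fin N) (Fin g) Fq[X]) :
    Set (Fin N → Ω) := Set.range fun y => α + φ.matAct B y

theorem lt_of_affineImage_ne_univ {g : ℕ} {B : Matrix (Fin N) (Fin g) Fq[X]}
    {C : Matrix (Fin g) (Fin N) Fq[X]} (hCB : C * B = 1) {α : Fin N → Ω}
    (hne : φ.affineImage α B ≠ Set.univ) : g < N := by
  refine lt_of_le_of_ne (le_of_matrix_mul_eq_one hCB) ?_
  rintro rfl
  refine hne (Set.eq_univ_of_forall fun x => ⟨φ.matAct C (x - α), ?_⟩)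
  change α + φ.matAct B (φ.matAct C (x - α)) = x
  rw [← matAct_mul, mul_eq_one_comm.1 hCB, matAct_one, add_sub_cancel]

variable [IsAlgClosed Ω]

/-- An irreducible algebraic `φ`-submodule is a split embedded power of `𝔾_a`. -/
theorem exists_eq_range_matAct (hi : Function.Injective i) (hE : φ.AdditiveEndEqA Ω)
    {W : Set (Fin N → Ω)} (hW : IsAlgebraicSubmodule φ W) (hirr : IsIrred K W) :
    ∃ (g : ℕ) (B : Matrix (Fin N) (Fin g) Fq[X]) (C : Matrix (Fin g) (Fin N) Fq[X]),
      C * B = 1 ∧ W = Set.range (φ.matAct B) := by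
  classical
  set R := φ.relations W with hR
  have htf : Module.IsTorsionFree Fq[X] ((Fin N → Fq[X]) ⧸ R) := by
    refine ⟨fun b hb => ?_⟩
    have hb0 : b ≠ 0 := hb.ne_zero
    intro x y hxy
    obtain ⟨x, rfl⟩ := R.mkQ_surjective x
    obtain ⟨y, rfl⟩ := R.mkQ_surjective y
    have h1 : b • (x - y) ∈ R := by
      rw [← Submodule.Quotient.mk_eq_zero, smul_sub, Submodule.Quotient.mk_sub, sub_eq_zero]
      exact hxy
    have h2 := φ.mem_relations_of_smul_mem hi hW.zero_mem hirr hb0 h1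
    exact (Submodule.Quotient.eq R).2 h2
  let e := (Module.finBasis Fq[X] ((Fin N → Fq[X]) ⧸ R)).equivFun
  set g := Module.finrank Fq[X] ((Fin N → Fq[X]) ⧸ R)
  let π : (Fin N → Fq[X]) →ₗ[Fq[X]] (Fin g → Fq[X]) := e.toLinearMap ∘ₗ R.mkQ
  have hπs : Function.Surjective π := e.surjective.comp R.mkQ_surjective
  have hπk : ∀ a, π a = 0 → a ∈ R := fun a h => by
    have : R.mkQ a = 0 := e.injective (by rw [map_zero]; exact h)
    rwa [← Submodule.Quotient.mk_eq_zero]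
  -- A^N/R is torsion-free over a PID, hence free. B is the matrix of the projection to it, acting
  -- on row vectors, and the rows of C lift a basis of the quotient.
  let B : Matrix (Fin N) (Fin g) Fq[X] := fun j => π (Pi.single j 1)
  choose s hs using fun k : Fin g => hπs (Pi.single k 1)
  let C : Matrix (Fin g) (Fin N) Fq[X] := s
  have hπB : ∀ v, π v = Matrix.vecMul v B := by
    intro v
    funext k
    conv_lhs => rw [pi_eq_sum_univ' v]
    simp only [map_sum, map_smul, Finset.sum_apply, Pi.smul_apply, smul_eq_mul, Matrix.vecMul,
      dotProduct, B]
  have hCB : C * B = 1 := by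
    funext k
    rw [Matrix.mul_apply_eq_vecMul, ← hπB]
    change π (s k) = _
    rw [hs]
    funext k'
    rw [Matrix.one_apply, Pi.single_apply]
    simp only [eq_comm]
  have hBC : ∀ x ∈ W, φ.matAct B (φ.matAct C x) = x := by
    intro x hx
    rw [← matAct_mul]
    funext j
    -- The rows of BC - 1 are killed by the projection, so they are relations: BC acts as the
    -- identity on W.
    have hmem : (B * C) j - Pi.single j 1 ∈ R := by
      apply hπk
      rw [_root_.map_sub, sub_eq_zero, hπB, ← Matrix.mul_apply_eq_vecMul, Matrix.mul_assoc, hCB,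
        Matrix.mul_one]
    have h1 := hmem x hx
    have h2 := congrFun (φ.matAct_one x) j
    simp only [Pi.sub_apply, act_sub_left, Finset.sum_sub_distrib, sub_eq_zero] at h1
    rw [matAct, h1, ← h2, matAct]
    refine Finset.sum_congr rfl fun k _ => ?_
    rw [Matrix.one_apply, Pi.single_apply]
    simp only [eq_comm]
  let W' : AddSubgroup (Fin g → Ω) :=
    { carrier := {y | φ.matAct B y ∈ W}
      zero_mem' := by simpa [matAct_zero] using hW.zero_mem
      add_mem' := fun {x y} hx hy => by
        simp only [Set.mem_ofPred_eq, matAct_add] at hx hy ⊢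
        exact hW.add_mem _ hx _ hy
      neg_mem' := fun {x} hx => by
        have h1 := hW.act_mem (-1) _ hx
        rw [← matAct_act] at h1
        have : (fun k => φ.act (-1) (x k)) = -x := by
          funext k; rw [act_neg_left, act_one]; rfl
        rwa [this] at h1 }
  -- If the preimage W' were proper it would satisfy a relation a ≠ 0. Then aC is a relation on W,
  -- so its class aCB = a is 0.
  have hW'univ : ∀ y, φ.matAct B y ∈ W := by
    by_contra! hne
    obtain ⟨y, hy⟩ := hne
    obtain ⟨P, hP0, hP⟩ := exists_polynomial_of_ne_univ
      (hW.isSubvariety.preimage (φ.isPolynomialMap_matAct B))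
      (fun h => hy (by have := h.symm.subset (Set.mem_univ y); exact this))
    obtain ⟨a, ha0, ha⟩ := φ.exists_act_relation hi hE W'
      (fun a x hx => by
        have h1 := hW.act_mem a _ hx
        rw [← matAct_act] at h1
        exact h1)
      ⟨MvPolynomial.map (algebraMap _ Ω) P, fun h => hP0 (MvPolynomial.map_injective _
        (algebraMap (separableClosure K Ω) Ω).injective (by rw [h, map_zero])), fun x hx => by
          rw [MvPolynomial.eval_map]; exact hP x hx⟩
    have hmem : Matrix.vecMul a C ∈ R := by
      intro x hx
      have h1 := ha (φ.matAct C x) (by change φ.matAct B _ ∈ W; rw [hBC x hx]; exact hx)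
      rw [← h1]
      simp only [Matrix.vecMul, dotProduct, matAct, act_sum, act_sum_left, act_mul]
      exact Finset.sum_comm
    have h2 : π (Matrix.vecMul a C) = 0 := by
      have : R.mkQ (Matrix.vecMul a C) = 0 := (Submodule.Quotient.mk_eq_zero R).2 hmem
      change e (R.mkQ _) = 0
      rw [this, map_zero]
    rw [hπB, Matrix.vecMul_vecMul, hCB, Matrix.vecMul_one] at h2
    exact ha0 h2
  refine ⟨g, B, C, hCB, Set.Subset.antisymm (fun x hx => ⟨_, hBC x hx⟩) ?_⟩
  rintro _ ⟨y, rfl⟩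
  exact hW'univ y

theorem isTorsionSubvariety_affineImage {g : ℕ} {B : Matrix (Fin N) (Fin g) Fq[X]}
    {C : Matrix (Fin g) (Fin N) Fq[X]} (hCB : C * B = 1) {α : Fin N → Ω}
    (hα : IsTorsionPoint φ α) : IsTorsionSubvariety φ (φ.affineImage α B) := by
  have hinf : Infinite Ω := IsAlgClosed.instInfinite
  refine ⟨_, α, φ.isAlgebraicSubmodule_range hCB, ?_, hα, ?_⟩
  · rw [← Set.image_univ]
    exact isIrred_univ.image (φ.isPolynomialMap_matAct B)
  · rw [affineImage, ← Set.range_comp]; rfl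

theorem exists_eq_affineImage (hi : Function.Injective i) (hE : φ.AdditiveEndEqA Ω)
    {T : Set (Fin N → Ω)} (hT : IsTorsionSubvariety φ T) :
    ∃ (g : ℕ) (α : Fin N → Ω) (B : Matrix (Fin N) (Fin g) Fq[X])
      (C : Matrix (Fin g) (Fin N) Fq[X]), C * B = 1 ∧ IsTorsionPoint φ α ∧
        T = φ.affineImage α B := by
  obtain ⟨W, α, hW, hirr, hα, rfl⟩ := hT
  obtain ⟨g, B, C, hCB, rfl⟩ := φ.exists_eq_range_matAct hi hE hW hirr
  refine ⟨g, α, B, C, hCB, hα, ?_⟩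
  rw [affineImage, ← Set.range_comp]; rfl

end DrinfeldModule
/-! ### Torsion subvarieties -/

namespace DrinfeldModule

variable {Fq : Type*} [Field Fq] [Fintype Fq] {K : Type*} [Field K] [Algebra Fq K]
  {i : Fq[X] →ₐ[Fq] K} (φ : DrinfeldModule i) {Ω : Type*} [Field Ω] [Algebra K Ω] {N : ℕ}

theorem isSubvariety_of_isTorsionSubvariety (hi : Function.Injective i) {T : Set (Fin N → Ω)}
    (hT : IsTorsionSubvariety φ T) : IsSubvariety K T := by
  obtain ⟨W, α, hW, -, hα, rfl⟩ := hT
  have hF : IsPolynomialMap K (fun x : Fin N → Ω => -α + x) :=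
    isPolynomialMap_add (F := fun x => x) ⟨fun j => MvPolynomial.X j, fun x j => by simp⟩ (-α)
      fun j => neg_mem (φ.isTorsionPoint_mem hi hα j)
  have := hW.isSubvariety.preimage hF
  rwa [Set.image_add_left]

theorem isIrred_of_isTorsionSubvariety (hi : Function.Injective i) {T : Set (Fin N → Ω)}
    (hT : IsTorsionSubvariety φ T) : IsIrred K T := by
  obtain ⟨W, α, -, hirr, hα, rfl⟩ := hT
  exact hirr.image (isPolynomialMap_add (F := fun x => x)
    ⟨fun j => MvPolynomial.X j, fun x j => by simp⟩ α fun j => φ.isTorsionPoint_mem hi hα j)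

theorem countable_torsion (hi : Function.Injective i) :
    (φ.torsion Ω : Set Ω).Countable := by
  have hA : Countable Fq[X] := by
    rw [← Cardinal.mk_le_aleph0_iff]
    exact Polynomial.cardinalMk_le_max.trans (max_le (Cardinal.mk_le_aleph0) le_rfl)
  have : (φ.torsion Ω : Set Ω) ⊆ ⋃ a : {a : Fq[X] // a ≠ 0}, {x : Ω | φ.act a.1 x = 0} := by
    rintro x ⟨a, ha, hx⟩
    exact Set.mem_iUnion.2 ⟨⟨a, ha⟩, hx⟩
  exact (Set.countable_iUnion fun a : {a : Fq[X] // a ≠ 0} =>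
    (φ.finite_ker hi a.1 a.2).countable).mono this

variable [IsAlgClosed Ω]

/-- A torsion subvariety is determined by g, a matrix over A and a torsion point. Countability
allows a sequence to avoid all the proper ones in turn. -/
theorem countable_isTorsionSubvariety (hi : Function.Injective i) (hE : φ.AdditiveEndEqA Ω) :
    {T : Set (Fin N → Ω) | IsTorsionSubvariety φ T}.Countable := by
  have hA : Countable Fq[X] := by
    rw [← Cardinal.mk_le_aleph0_iff]
    exact Polynomial.cardinalMk_le_max.trans (max_le (Cardinal.mk_le_aleph0) le_rfl)
  have : Countable (φ.torsion Ω) := (φ.countable_torsion hi).to_subtype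
  refine (Set.countable_range fun p : (Σ g : ℕ, (Fin N → Fin g → Fq[X]) × (Fin N → φ.torsion Ω)) =>
    φ.affineImage (fun j => (p.2.2 j : Ω)) p.2.1).mono ?_
  intro T hT
  obtain ⟨g, α, B, C, -, hα, rfl⟩ := φ.exists_eq_affineImage hi hE hT
  exact ⟨⟨g, B, fun j => ⟨α j, φ.isTorsionPoint_apply hα j⟩⟩, rfl⟩

/-- If finite, the torsion would be killed by one c ≠ 0. Dividing a nonzero t-torsion point by c
gives a torsion point that c does not kill. -/
theorem infinite_torsion (hi : Function.Injective i) : (φ.torsion Ω : Set Ω).Infinite := by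
  classical
  intro hfin
  obtain ⟨c, hc0, hc⟩ := φ.exists_act_eq_zero_of_finite hfin fun a x hx => by
    obtain ⟨b, hb, h⟩ := hx
    exact ⟨b, hb, by rw [← act_mul, mul_comm, act_mul, h, act_zero]⟩
  obtain ⟨x, hx0, hx⟩ : ∃ x : Ω, x ≠ 0 ∧ φ.act X x = 0 := by
    by_contra! h
    have hP0 := φ.poly_ne_zero (L := Ω) hi X_ne_zero
    have hsub : (φ.poly Ω X).roots ≤ {0} := by
      rw [Multiset.le_iff_subset (nodup_roots ((φ.isAdditivePoly_poly X).separable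
        (φ.coeff_poly_one_ne_zero hi X_ne_zero)))]
      intro x hx
      rw [mem_roots hP0, IsRoot.def, eval_poly] at hx
      rw [Multiset.mem_singleton]
      by_contra hne
      exact h x hne hx
    have h1 := Multiset.card_le_card hsub
    rw [← (IsAlgClosed.splits (φ.poly Ω X)).natDegree_eq_card_roots, poly, natDegree_map,
      Multiset.card_singleton] at h1
    have := φ.one_lt_natDegree
    omega
  obtain ⟨y, rfl⟩ := φ.act_surjective hi c hc0 x
  exact hx0 (hc y ⟨X * c, mul_ne_zero X_ne_zero hc0, by rw [act_mul, hx]⟩)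

/-- Torsion points are Zariski dense in torsion subvarieties. -/
theorem subset_of_torsionPoints_subset (hi : Function.Injective i) (hE : φ.AdditiveEndEqA Ω)
    {T V : Set (Fin N → Ω)} (hT : IsTorsionSubvariety φ T) (hV : IsSubvariety K V)
    (h : ∀ x ∈ T, IsTorsionPoint φ x → x ∈ V) : T ⊆ V := by
  obtain ⟨g, α, B, C, hCB, hα, rfl⟩ := φ.exists_eq_affineImage hi hE hT
  obtain ⟨f, hf⟩ := (isPolynomialMap_add (φ.isPolynomialMap_matAct B) α
    (φ.isTorsionPoint_mem hi hα)).exists_comap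
  obtain ⟨I, rfl⟩ := hV
  rintro _ ⟨y, rfl⟩ P hP
  have hz : MvPolynomial.map (algebraMap _ Ω) (f P) = 0 := by
    -- Pulled back to 𝔾_a^g, an equation of V vanishes on a product of infinite sets of torsion
    -- points, so it is zero.
    refine MvPolynomial.funext_set (fun _ => (φ.torsion Ω : Set Ω))
      (fun _ => φ.infinite_torsion hi) fun z hz => ?_
    have hz' : IsTorsionPoint φ z := φ.isTorsionPoint_of_forall fun j => hz j trivial
    rw [map_zero, MvPolynomial.eval_map]
    refine (hf P z).trans ?_
    exact h _ ⟨z, rfl⟩ (φ.isTorsionPoint_add hα (φ.isTorsionPoint_matAct B hz')) P hP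
  have h1 := congrArg (MvPolynomial.eval y) hz
  rw [map_zero, MvPolynomial.eval_map] at h1
  exact (hf P y).symm.trans h1

end DrinfeldModule
/-! ### Heights -/

section Average

variable {K F E : Type*} [Field K] [Field F] [Algebra K F] [Field E] [Algebra K E]

theorem sum_adjoin_embeddings (x : F) (hx : IsSeparable K x) (f : E → ℝ)
    [Fintype (IntermediateField.adjoin K {x} →ₐ[K] E)] :
    ∑ σ : IntermediateField.adjoin K {x} →ₐ[K] E, f (σ (IntermediateField.AdjoinSimple.gen K x))
      = (((minpoly K x).aroots E).map f).sum := by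
  classical
  let pb := IntermediateField.adjoin.powerBasis hx.isIntegral
  have hgen : pb.gen = IntermediateField.AdjoinSimple.gen K x := rfl
  have hmin : minpoly K pb.gen = minpoly K x := by
    rw [hgen, IntermediateField.minpoly_gen]
  rw [← hmin, Fintype.sum_equiv pb.liftEquiv' _ (fun y => f y.1), Finset.sum_mem_multiset _ _ f,
    Finset.sum_eq_multiset_sum, Multiset.toFinset_val, Multiset.dedup_eq_self.mpr]
  · rw [hmin]; exact nodup_roots ((separable_map _).mpr hx)
  · intro x; rfl
  · intro σ
    rw [PowerBasis.liftEquiv'_apply_coe, hgen]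

/-- Each embedding of K(x) extends to F in [F : K(x)] ways. Averaging over embeddings of one field F
lets several elements be conjugated simultaneously. -/
theorem sum_embeddings_eq_sum_roots [IsAlgClosed E] [FiniteDimensional K F]
    [Algebra.IsSeparable K F] (x : F) (f : E → ℝ) : (∑ σ : F →ₐ[K] E, f (σ x)) / Module.finrank K F
      = (((minpoly K x).aroots E).map f).sum / (minpoly K x).natDegree := by
  classical
  have hx := Algebra.IsSeparable.isSeparable K x
  set L := IntermediateField.adjoin K {x}
  have : FiniteDimensional L F := FiniteDimensional.right K L F
  have : FiniteDimensional K L := IntermediateField.adjoin.finiteDimensional hx.isIntegral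
  have : Algebra.IsSeparable L F := Algebra.isSeparable_tower_top_of_isSeparable K L F
  have h1 : ∑ σ : F →ₐ[K] E, f (σ x)
      = Module.finrank L F * ∑ σ : L →ₐ[K] E, f (σ (IntermediateField.AdjoinSimple.gen K x)) := by
    rw [Fintype.sum_equiv algHomEquivSigma (fun σ : F →ₐ[K] E => _)
      fun σ => f (σ.1 (IntermediateField.AdjoinSimple.gen K x)),
      ← Finset.univ_sigma_univ, Finset.sum_sigma, Finset.mul_sum]
    · refine Finset.sum_congr rfl fun σ _ => ?_
      let : Algebra L E := σ.toRingHom.toAlgebra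
      simp_rw [Finset.sum_const, Finset.card_univ, ← AlgHom.card L F E, nsmul_eq_mul]
      rfl
    · intro σ
      simp only [algHomEquivSigma, Equiv.coe_fn_mk, AlgHom.domRestrict, AlgHom.comp_apply,
        IsScalarTower.coe_toAlgHom']
      rfl
  have h2 : (minpoly K x).natDegree = Module.finrank K L :=
    (IntermediateField.adjoin.finrank hx.isIntegral).symm
  have h3 : (0 : ℝ) < Module.finrank L F := by exact_mod_cast Module.finrank_pos
  rw [h1, sum_adjoin_embeddings x hx, h2, ← Module.finrank_mul_finrank K L F, Nat.cast_mul,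
    mul_comm (Module.finrank K L : ℝ), mul_div_mul_left _ _ h3.ne']

end Average

/-! ### Size of polynomial values for one nonarchimedean absolute value -/

section Local

/-- The total size of the coefficients of `P` with respect to `v`. -/
noncomputable def coeffHeight {K : Type*} [Field K] (v : AbsoluteValue K ℝ) (P : K[X]) : ℝ :=
  ∑ k ∈ Finset.range (P.natDegree + 1), Real.posLog (v (P.coeff k))

theorem coeffHeight_nonneg {K : Type*} [Field K] (v : AbsoluteValue K ℝ) (P : K[X]) :
    0 ≤ coeffHeight v P := Finset.sum_nonneg fun _ _ => Real.posLog_nonneg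

variable {E : Type*} [Field E] (n : AbsoluteValue E ℝ)

theorem posLog_add_le (hn : IsNonarchimedean n) (x y : E) :
    Real.posLog (n (x + y)) ≤ Real.posLog (n x) + Real.posLog (n y) := by
  have h1 := Real.posLog_le_posLog (n.nonneg _) (hn x y)
  rcases le_total (n x) (n y) with h | h
  · rw [max_eq_right h] at h1
    linarith [Real.posLog_nonneg (x := n x)]
  · rw [max_eq_left h] at h1
    linarith [Real.posLog_nonneg (x := n y)]

theorem posLog_eval_le (hn : IsNonarchimedean n) (P : E[X]) (y : E) :
    Real.posLog (n (P.eval y)) ≤ P.natDegree * Real.posLog (n y) + coeffHeight n P := by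
  obtain ⟨k, hk, hle⟩ := IsNonarchimedean.finset_image_add (map_zero n) n.nonneg hn
    (fun k => P.coeff k * y ^ k) (Finset.range (P.natDegree + 1))
  have hk := hk ⟨0, by simp⟩
  rw [← eval_eq_sum_range] at hle
  refine (Real.posLog_le_posLog (n.nonneg _) hle).trans ?_
  rw [map_mul, map_pow]
  refine Real.posLog_mul.trans ?_
  rw [Real.posLog_pow, add_comm]
  refine add_le_add ?_ ?_
  · refine mul_le_mul_of_nonneg_right ?_ Real.posLog_nonneg
    exact_mod_cast Nat.lt_succ_iff.1 (Finset.mem_range.1 hk)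
  · exact Finset.single_le_sum (f := fun k => Real.posLog (n (P.coeff k)))
      (fun _ _ => Real.posLog_nonneg) hk

theorem mul_posLog_le (hn : IsNonarchimedean n) (P : E[X]) (hP : 0 < P.natDegree) (y : E) :
    P.natDegree * Real.posLog (n y) ≤ Real.posLog (n (P.eval y)) +
      P.natDegree * (Real.posLog (n P.leadingCoeff⁻¹) + coeffHeight n (C P.leadingCoeff⁻¹ * P)) := by
  set d := P.natDegree with hd
  set l := P.leadingCoeff with hl
  have hd1 : (1 : ℝ) ≤ d := by exact_mod_cast hP
  have hl0 : l ≠ 0 := by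
    rw [hl, leadingCoeff_ne_zero]; rintro rfl; simp [hd] at hP
  have hA := Real.posLog_nonneg (x := n l⁻¹)
  have hB := coeffHeight_nonneg n (C l⁻¹ * P)
  have hC := Real.posLog_nonneg (x := n (P.eval y))
  rcases le_or_gt (n y) 1 with h1 | h1
  · have : Real.posLog (n y) = 0 := by
      rw [Real.posLog_eq_zero_iff, abs_of_nonneg (n.nonneg _)]; exact h1
    rw [this, mul_zero]
    positivity
  -- Solve for y^d. The largest term on the right dominates: either it is P(y)/l, or some normalized
  -- coefficient already bounds |y|.
  have hsum : y ^ d = ∑ k ∈ Finset.range (d + 1),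
      if k = d then l⁻¹ * P.eval y else -(l⁻¹ * P.coeff k * y ^ k) := by
    rw [Finset.sum_range_succ, if_pos rfl]
    have h2 : P.eval y = ∑ k ∈ Finset.range d, P.coeff k * y ^ k + l * y ^ d := by
      rw [eval_eq_sum_range, Finset.sum_range_succ]; rfl
    have h3 : ∑ k ∈ Finset.range d, (if k = d then l⁻¹ * P.eval y else -(l⁻¹ * P.coeff k * y ^ k))
        = -(l⁻¹ * ∑ k ∈ Finset.range d, P.coeff k * y ^ k) := by
      rw [Finset.mul_sum, ← Finset.sum_neg_distrib]
      refine Finset.sum_congr rfl fun k hk => ?_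
      rw [if_neg (Finset.mem_range.1 hk).ne]; ring
    rw [h3, h2, mul_add, inv_mul_cancel_left₀ hl0]
    ring
  obtain ⟨k, hk, hle⟩ := IsNonarchimedean.finset_image_add (map_zero n) n.nonneg hn
    (fun k => if k = d then l⁻¹ * P.eval y else -(l⁻¹ * P.coeff k * y ^ k)) (Finset.range (d + 1))
  have hk := Finset.mem_range.1 (hk ⟨0, by simp⟩)
  rw [← hsum] at hle
  by_cases hkd : k = d
  · simp only [hkd, if_true] at hle
    have h2 := Real.posLog_le_posLog (n.nonneg _) hle
    rw [map_pow, Real.posLog_pow, map_mul] at h2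
    have h3 := h2.trans Real.posLog_mul
    nlinarith
  · simp only [hkd, if_false] at hle
    rw [map_neg_eq_map, map_mul, map_pow, map_pow] at hle
    have hklt : k < d := by omega
    have hpos : 0 < n y ^ k := by positivity
    have h2 : n y ≤ n (l⁻¹ * P.coeff k) := by
      have h3 : n y ^ d = n y ^ (d - k) * n y ^ k := by rw [← pow_add, Nat.sub_add_cancel hklt.le]
      rw [h3] at hle
      exact (le_self_pow₀ h1.le (by omega)).trans (le_of_mul_le_mul_right hle hpos)
    have h4 : Real.posLog (n y) ≤ coeffHeight n (C l⁻¹ * P) := by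
      refine (Real.posLog_le_posLog (n.nonneg _) h2).trans ?_
      rw [← coeff_C_mul]
      refine Finset.single_le_sum (f := fun k => Real.posLog (n ((C l⁻¹ * P).coeff k)))
        (fun _ _ => Real.posLog_nonneg) ?_
      rw [Finset.mem_range, natDegree_C_mul (inv_ne_zero hl0)]
      exact hk
    nlinarith

end Local

/-! ### Local heights -/

section Place

variable {K : Type*} [Field K]

theorem exists_extension (v : AbsoluteValue K ℝ) (hv : v.IsNontrivial) (hna : IsNonarchimedean v) :
    ∃ n : AbsoluteValue (AlgebraicClosure v.Completion) ℝ, IsNonarchimedean n ∧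
      (∀ y, n y = spectralNorm v.Completion (AlgebraicClosure v.Completion) y) ∧
      ∀ x : K, n (algebraMap K _ x) = v x := by
  have hcoe : ∀ x : K, ‖algebraMap K v.Completion x‖ = v x := fun x => by
    have h : algebraMap K v.Completion x = ((WithAbs.toAbs v x : WithAbs v) : v.Completion) := rfl
    rw [h, UniformSpace.Completion.norm_coe, WithAbs.norm_eq_apply_ofAbs]
  have hult : IsUltrametricDist v.Completion := by
    refine IsUltrametricDist.isUltrametricDist_of_forall_norm_add_le_max_norm fun x y => ?_
    induction x, y using UniformSpace.Completion.induction_on₂ with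
    | hp => exact isClosed_le (by fun_prop) (by fun_prop)
    | ih x y =>
      rw [← UniformSpace.Completion.coe_add]
      simp only [UniformSpace.Completion.norm_coe, WithAbs.norm_eq_apply_ofAbs, WithAbs.ofAbs_add]
      exact hna _ _
  let _ : NontriviallyNormedField v.Completion :=
    { non_trivial := by
        obtain ⟨x, hx⟩ := hv.exists_abv_gt_one
        exact ⟨algebraMap K v.Completion x, by rw [hcoe]; exact hx⟩ }
  let s := spectralMulAlgNorm v.Completion (AlgebraicClosure v.Completion)
  let n : AbsoluteValue (AlgebraicClosure v.Completion) ℝ :=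
    { toFun := s
      map_mul' := map_mul s
      nonneg' := apply_nonneg s
      eq_zero' := fun x => map_eq_zero_iff_eq_zero s
      add_le' := map_add_le_add s }
  refine ⟨n, isNonarchimedean_spectralNorm, fun y => rfl, fun x => ?_⟩
  rw [IsScalarTower.algebraMap_apply K v.Completion]
  exact (spectralNorm_extends (L := AlgebraicClosure v.Completion) _).trans (hcoe x)

theorem coeffHeight_map {E : Type*} [Field E] [Algebra K E] {n : AbsoluteValue E ℝ}
    {v : AbsoluteValue K ℝ} (h : ∀ x : K, n (algebraMap K E x) = v x) (P : K[X]) :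
    coeffHeight n (P.map (algebraMap K E)) = coeffHeight v P := by
  simp only [coeffHeight, natDegree_map, coeff_map, h]

/-- The constant in the lower bound for the size of the values of `P`. -/
noncomputable def lowerConst (v : AbsoluteValue K ℝ) (P : K[X]) : ℝ :=
  P.natDegree * (Real.posLog (v P.leadingCoeff⁻¹) + coeffHeight v (C P.leadingCoeff⁻¹ * P))

theorem ProductFormulaFamily.finite_posLog {ι : Type*} (M : ProductFormulaFamily K ι) (c : K) :
    {v | Real.posLog (M.abv v c) ≠ 0}.Finite := by
  by_cases hc : c = 0
  · simp [hc]
  · refine (M.finite c hc).subset fun v hv h1 => hv ?_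
    rw [h1, Real.posLog_one]

theorem ProductFormulaFamily.finite_coeffHeight {ι : Type*} (M : ProductFormulaFamily K ι)
    (P : K[X]) : {v | coeffHeight (M.abv v) P ≠ 0}.Finite := by
  refine (Set.Finite.biUnion (Finset.range (P.natDegree + 1)).finite_toSet fun k _ =>
    M.finite_posLog (P.coeff k)).subset fun v hv => ?_
  by_contra h
  simp only [Set.mem_iUnion, not_exists, Set.mem_ofPred_eq, not_not] at h
  exact hv (Finset.sum_eq_zero fun k hk => h k (by simpa using hk))

theorem ProductFormulaFamily.finite_lowerConst {ι : Type*} (M : ProductFormulaFamily K ι)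
    (P : K[X]) : {v | lowerConst (M.abv v) P ≠ 0}.Finite := by
  refine ((M.finite_posLog P.leadingCoeff⁻¹).union
    (M.finite_coeffHeight (C P.leadingCoeff⁻¹ * P))).subset fun v hv => ?_
  by_contra h
  simp only [Set.mem_union, Set.mem_ofPred_eq, not_or, not_not] at h
  exact hv (by rw [lowerConst, h.1, h.2]; simp)

variable {L : Type*} [Field L] [Algebra K L]

theorem localHeight_nonneg (v : AbsoluteValue K ℝ) (x : L) : 0 ≤ localHeight v x :=
  div_nonneg (Multiset.sum_nonneg fun y hy => by
    obtain ⟨z, -, rfl⟩ := Multiset.mem_map.1 hy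
    exact Real.posLog_nonneg) (Nat.cast_nonneg _)

variable [Algebra.IsSeparable K L]

theorem localHeight_eq (v : AbsoluteValue K ℝ) (F : IntermediateField K L)
    [FiniteDimensional K F] (x : F) : localHeight v (x : L)
      = (∑ σ : F →ₐ[K] AlgebraicClosure v.Completion, Real.posLog
          (spectralNorm v.Completion (AlgebraicClosure v.Completion) (σ x)))
        / Module.finrank K F := by
  rw [sum_embeddings_eq_sum_roots x fun y => Real.posLog
    (spectralNorm v.Completion (AlgebraicClosure v.Completion) y), localHeight]
  rw [show minpoly K (x : L) = minpoly K x from minpoly.algebraMap_eq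
    (algebraMap F L).injective x]

/-- All three heights are averages over the embeddings of K(x, y), where the ultrametric bound
applies embedding by embedding. -/
theorem localHeight_add_le {v : AbsoluteValue K ℝ} (hv : v.IsNontrivial)
    (hna : IsNonarchimedean v) (x y : L) :
    localHeight v (x + y) ≤ localHeight v x + localHeight v y := by
  obtain ⟨n, hn, hns, -⟩ := exists_extension v hv hna
  have hx := Algebra.IsSeparable.isIntegral K x
  have hy := Algebra.IsSeparable.isIntegral K y
  have := IntermediateField.finiteDimensional_adjoin_pair hx hy
  set F := IntermediateField.adjoin K {x, y}
  let x' : F := ⟨x, IntermediateField.subset_adjoin K _ (by simp)⟩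
  let y' : F := ⟨y, IntermediateField.subset_adjoin K _ (by simp)⟩
  rw [localHeight_eq v F x', localHeight_eq v F y', show x + y = ((x' + y' : F) : L) from rfl,
    localHeight_eq v F, ← add_div, ← Finset.sum_add_distrib]
  refine div_le_div_of_nonneg_right (Finset.sum_le_sum fun σ _ => ?_) (Nat.cast_nonneg _)
  simp only [← hns, map_add]
  exact posLog_add_le n hn _ _

theorem sum_const_div_finrank (F : Type*) [Field F] [Algebra K F] [FiniteDimensional K F]
    [Algebra.IsSeparable K F] (E : Type*) [Field E] [Algebra K E] [IsAlgClosed E] (c : ℝ) :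
    (∑ _σ : F →ₐ[K] E, c) / Module.finrank K F = c := by
  rw [Finset.sum_const, Finset.card_univ, AlgHom.card, nsmul_eq_mul, mul_div_assoc, mul_comm,
    div_mul_cancel₀]
  exact_mod_cast Module.finrank_pos.ne'

theorem localHeight_aeval_le {v : AbsoluteValue K ℝ} (hv : v.IsNontrivial)
    (hna : IsNonarchimedean v) (P : K[X]) (x : L) :
    localHeight v (aeval x P) ≤ P.natDegree * localHeight v x + coeffHeight v P := by
  obtain ⟨n, hn, hns, hnv⟩ := exists_extension v hv hna
  have hx := Algebra.IsSeparable.isIntegral K x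
  have := IntermediateField.adjoin.finiteDimensional hx
  set F := IntermediateField.adjoin K {x}
  let x' : F := ⟨x, IntermediateField.subset_adjoin K _ (by simp)⟩
  have h1 : aeval x P = ((aeval x' P : F) : L) := aeval_algebraMap_apply L x' P
  rw [h1, localHeight_eq v F, localHeight_eq v F x',
    ← sum_const_div_finrank (K := K) F (AlgebraicClosure v.Completion) (coeffHeight v P),
    ← mul_div_assoc, ← add_div, Finset.mul_sum, ← Finset.sum_add_distrib]
  refine div_le_div_of_nonneg_right (Finset.sum_le_sum fun σ _ => ?_) (Nat.cast_nonneg _)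
  have h2 := posLog_eval_le n hn (P.map (algebraMap K _)) (σ x')
  rwa [coeffHeight_map hnv, natDegree_map, eval_map_algebraMap, aeval_algHom_apply, hns, hns] at h2

theorem mul_localHeight_le {v : AbsoluteValue K ℝ} (hv : v.IsNontrivial)
    (hna : IsNonarchimedean v) (P : K[X]) (hP : 0 < P.natDegree) (x : L) :
    P.natDegree * localHeight v x ≤ localHeight v (aeval x P) + lowerConst v P := by
  obtain ⟨n, hn, hns, hnv⟩ := exists_extension v hv hna
  have hx := Algebra.IsSeparable.isIntegral K x
  have := IntermediateField.adjoin.finiteDimensional hx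
  set F := IntermediateField.adjoin K {x}
  let x' : F := ⟨x, IntermediateField.subset_adjoin K _ (by simp)⟩
  have h1 : aeval x P = ((aeval x' P : F) : L) := aeval_algebraMap_apply L x' P
  rw [h1, localHeight_eq v F, localHeight_eq v F x',
    ← sum_const_div_finrank (K := K) F (AlgebraicClosure v.Completion) (lowerConst v P),
    ← mul_div_assoc, ← add_div, Finset.mul_sum, ← Finset.sum_add_distrib]
  refine div_le_div_of_nonneg_right (Finset.sum_le_sum fun σ _ => ?_) (Nat.cast_nonneg _)
  have h2 := mul_posLog_le n hn (P.map (algebraMap K _)) (by rwa [natDegree_map]) (σ x')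
  rw [leadingCoeff_map, ← map_inv₀, ← map_C, ← Polynomial.map_mul, coeffHeight_map hnv,
    natDegree_map, eval_map_algebraMap, aeval_algHom_apply, hns, hns, hnv] at h2
  exact h2

end Place
-- The Weil height
section WeilHeight

variable {K : Type*} [Field K] {ι : Type*} (M : ProductFormulaFamily K ι)
  {L : Type*} [Field L] [Algebra K L]

theorem weilHeight_nonneg (x : L) : 0 ≤ weilHeight M x :=
  finsum_nonneg fun v => localHeight_nonneg (M.abv v) x

variable [Algebra.IsSeparable K L]

/-- Apply the lower bound for polynomial values to the minimal polynomial of x, whose value at x is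
0: the local height vanishes wherever `lowerConst` does. -/
theorem finite_support_localHeight (x : L) :
    (Function.support fun v => localHeight (M.abv v) x).Finite := by
  have hx := Algebra.IsSeparable.isIntegral K x
  have hd := minpoly.natDegree_pos hx
  refine ((M.finite_lowerConst (minpoly K x)).union (M.finite_posLog (0 : K))).subset
    fun v hv => ?_
  by_contra h
  simp only [Set.mem_union, Set.mem_ofPred_eq, not_or, not_not] at h
  refine hv ?_
  have h1 := mul_localHeight_le (M.nontrivial v) (M.nonarch v) (minpoly K x) hd x
  have h2 := localHeight_aeval_le (M.nontrivial v) (M.nonarch v) 0 x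
  rw [minpoly.aeval, h.1, add_zero] at h1
  simp only [map_zero, natDegree_zero, Nat.cast_zero, zero_mul, zero_add] at h2
  have h3 : coeffHeight (M.abv v) 0 = 0 := by simp [coeffHeight]
  have h4 := localHeight_nonneg (M.abv v) x
  have h5 : (0 : ℝ) < (minpoly K x).natDegree := by exact_mod_cast hd
  rw [h3] at h2
  nlinarith

theorem weilHeight_add_le (x y : L) :
    weilHeight M (x + y) ≤ weilHeight M x + weilHeight M y := by
  have hx := finite_support_localHeight M x
  have hy := finite_support_localHeight M y
  rw [weilHeight, weilHeight, weilHeight, ← finsum_add_distrib hx hy]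
  exact finsum_le_finsum' (finite_support_localHeight M (x + y))
    ((hx.union hy).subset (Function.support_add _ _))
    fun v => localHeight_add_le (M.nontrivial v) (M.nonarch v) x y

theorem weilHeight_aeval_le (P : K[X]) : ∃ C : ℝ, ∀ x : L,
    weilHeight M (aeval x P) ≤ P.natDegree * weilHeight M x + C := by
  refine ⟨∑ᶠ v, coeffHeight (M.abv v) P, fun x => ?_⟩
  have hx := finite_support_localHeight M x
  have hx' : (Function.support fun v => (P.natDegree : ℝ) * localHeight (M.abv v) x).Finite :=
    hx.subset (Function.support_const_smul_subset (P.natDegree : ℝ) _)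
  rw [weilHeight, weilHeight, mul_finsum, ← finsum_add_distrib hx' (M.finite_coeffHeight P)]
  · exact finsum_le_finsum' (finite_support_localHeight M _)
      ((hx'.union (M.finite_coeffHeight P)).subset (Function.support_add _ _))
      fun v => localHeight_aeval_le (M.nontrivial v) (M.nonarch v) P x

theorem mul_weilHeight_le (P : K[X]) (hP : 0 < P.natDegree) : ∃ C : ℝ, ∀ x : L,
    P.natDegree * weilHeight M x ≤ weilHeight M (aeval x P) + C := by
  refine ⟨∑ᶠ v, lowerConst (M.abv v) P, fun x => ?_⟩
  have hx := finite_support_localHeight M x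
  have hx' : (Function.support fun v => (P.natDegree : ℝ) * localHeight (M.abv v) x).Finite :=
    hx.subset (Function.support_const_smul_subset (P.natDegree : ℝ) _)
  have hP' := finite_support_localHeight M (aeval x P)
  rw [weilHeight, weilHeight, mul_finsum, ← finsum_add_distrib hP' (M.finite_lowerConst P)]
  · exact finsum_le_finsum' hx'
      ((hP'.union (M.finite_lowerConst P)).subset (Function.support_add _ _))
      fun v => mul_localHeight_le (M.nontrivial v) (M.nonarch v) P hP x

end WeilHeight

/-! ### The canonical height -/

section CanonicalHeight

variable {Fq : Type*} [Field Fq] [Fintype Fq] {K : Type*} [Field K] [Algebra Fq K]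
  {i : Fq[X] →ₐ[Fq] K} (φ : DrinfeldModule i) {ι : Type*} (M : ProductFormulaFamily K ι)
  {L : Type*} [Field L] [Algebra K L] [Algebra.IsSeparable K L]

/-- Tate's argument: h(φ_t(y)) - d·h(y) is bounded with d = deg φ_t, so successive terms differ by a
geometric sequence. -/
theorem tendsto_canonicalHeight (x : L) :
    Tendsto (fun n : ℕ => weilHeight M (φ.act (X ^ n) x) / ((φ.toFun X).natDegree : ℝ) ^ n)
      atTop (𝓝 (canonicalHeight φ M x)) := by
  have hd : (1 : ℝ) < (φ.toFun X).natDegree := by exact_mod_cast φ.one_lt_natDegree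
  set d : ℝ := ((φ.toFun X).natDegree : ℝ)
  obtain ⟨C₁, h₁⟩ := weilHeight_aeval_le M (L := L) (φ.toFun X)
  obtain ⟨C₂, h₂⟩ := mul_weilHeight_le M (L := L) (φ.toFun X)
    (zero_lt_one.trans φ.one_lt_natDegree)
  refine CauchySeq.tendsto_limUnder (cauchySeq_of_le_geometric (1 / d) (max C₁ C₂ / d)
    ((div_lt_one (by positivity)).2 hd) fun n => ?_)
  have hpos : (0 : ℝ) < d ^ n := by positivity
  have hy : φ.act (X ^ (n + 1)) x = aeval (φ.act (X ^ n) x) (φ.toFun X) := by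
    rw [pow_succ', φ.act_mul]; rfl
  have h1 := h₁ (φ.act (X ^ n) x)
  have h2 := h₂ (φ.act (X ^ n) x)
  rw [← hy] at h1 h2
  set u := weilHeight M (φ.act (X ^ n) x)
  set u' := weilHeight M (φ.act (X ^ (n + 1)) x)
  have h3 : dist (u / d ^ n) (u' / d ^ (n + 1)) = |d * u - u'| / d ^ (n + 1) := by
    rw [Real.dist_eq, ← abs_of_pos (show (0 : ℝ) < d ^ (n + 1) by positivity), ← abs_div,
      abs_of_pos (show (0 : ℝ) < d ^ (n + 1) by positivity)]
    congr 1
    field_simp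
    ring
  have h4 : max C₁ C₂ / d * (1 / d) ^ n = max C₁ C₂ / d ^ (n + 1) := by
    rw [one_div, inv_pow, pow_succ]; field_simp
  rw [h3, h4]
  refine div_le_div_of_nonneg_right (abs_le.2 ⟨?_, ?_⟩) (by positivity)
  · have := le_max_left C₁ C₂; linarith
  · have := le_max_right C₁ C₂; linarith

theorem canonicalHeight_nonneg (x : L) : 0 ≤ canonicalHeight φ M x :=
  ge_of_tendsto' (tendsto_canonicalHeight φ M x) fun n =>
    div_nonneg (weilHeight_nonneg M _) (by positivity)

theorem canonicalHeight_add_le (x y : L) :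
    canonicalHeight φ M (x + y) ≤ canonicalHeight φ M x + canonicalHeight φ M y := by
  refine le_of_tendsto_of_tendsto' (tendsto_canonicalHeight φ M (x + y))
    ((tendsto_canonicalHeight φ M x).add (tendsto_canonicalHeight φ M y)) fun n => ?_
  rw [← add_div, φ.act_add]
  exact div_le_div_of_nonneg_right (weilHeight_add_le M _ _) (by positivity)

theorem tendsto_const_div_natDegree_pow (C : ℝ) :
    Tendsto (fun n : ℕ => C / ((φ.toFun X).natDegree : ℝ) ^ n) atTop (𝓝 0) :=
  tendsto_const_nhds.div_atTop
    (tendsto_pow_atTop_atTop_of_one_lt (by exact_mod_cast φ.one_lt_natDegree))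

theorem canonicalHeight_act_le (a : Fq[X]) (x : L) :
    canonicalHeight φ M (φ.act a x) ≤ (φ.toFun a).natDegree * canonicalHeight φ M x := by
  obtain ⟨C, h⟩ := weilHeight_aeval_le M (L := L) (φ.toFun a)
  have h0 := ((tendsto_canonicalHeight φ M x).const_mul ((φ.toFun a).natDegree : ℝ)).add
    (tendsto_const_div_natDegree_pow φ C)
  rw [add_zero] at h0
  refine le_of_tendsto_of_tendsto' (tendsto_canonicalHeight φ M (φ.act a x)) h0 fun n => ?_
  rw [← mul_div_assoc, ← add_div, ← φ.act_mul, mul_comm, φ.act_mul]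
  exact div_le_div_of_nonneg_right (h _) (by positivity)

/-- The points φ_{t^n}(x) stay in the finite kernel of φ_a, so their Weil heights are bounded. -/
theorem canonicalHeight_eq_zero (hi : Function.Injective i) {x : L} (hx : x ∈ φ.torsion L) :
    canonicalHeight φ M x = 0 := by
  obtain ⟨a, ha, hax⟩ := hx
  obtain ⟨B, hB⟩ : ∃ B : ℝ, ∀ n : ℕ, weilHeight M (φ.act (X ^ n) x) ≤ B := by
    obtain ⟨B, hB⟩ := ((φ.finite_ker (L := L) hi a ha).image (weilHeight M)).bddAbove
    refine ⟨B, fun n => hB ⟨_, ?_, rfl⟩⟩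
    rw [Set.mem_ofPred_eq, ← φ.act_mul, mul_comm, φ.act_mul, hax, φ.act_zero]
  refine le_antisymm ?_ (canonicalHeight_nonneg φ M x)
  exact le_of_tendsto_of_tendsto' (tendsto_canonicalHeight φ M x)
    (tendsto_const_div_natDegree_pow φ B) fun n =>
      div_le_div_of_nonneg_right (hB n) (by positivity)

theorem canonicalHeight_sum_le (hi : Function.Injective i) {σ : Type*} (s : Finset σ) (x : σ → L) :
    canonicalHeight φ M (∑ k ∈ s, x k) ≤ ∑ k ∈ s, canonicalHeight φ M (x k) := by
  classical
  induction s using Finset.induction_on with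
  | empty =>
    rw [Finset.sum_empty, Finset.sum_empty,
      canonicalHeight_eq_zero φ M hi (φ.torsion L).zero_mem]
  | insert k s hk ih =>
    rw [Finset.sum_insert hk, Finset.sum_insert hk]
    exact (canonicalHeight_add_le φ M _ _).trans (by linarith)

theorem canonicalHeightVec_nonneg {N : ℕ} (x : Fin N → L) : 0 ≤ canonicalHeightVec φ M x :=
  Finset.sum_nonneg fun j _ => canonicalHeight_nonneg φ M (x j)

theorem canonicalHeightVec_add_le {N : ℕ} (x y : Fin N → L) :
    canonicalHeightVec φ M (x + y) ≤ canonicalHeightVec φ M x + canonicalHeightVec φ M y := by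
  rw [canonicalHeightVec, canonicalHeightVec, canonicalHeightVec, ← Finset.sum_add_distrib]
  exact Finset.sum_le_sum fun j _ => canonicalHeight_add_le φ M _ _

theorem canonicalHeightVec_eq_zero (hi : Function.Injective i) {N : ℕ} {x : Fin N → L}
    (h : ∀ j, x j ∈ φ.torsion L) :
    canonicalHeightVec φ M x = 0 :=
  Finset.sum_eq_zero fun j _ => canonicalHeight_eq_zero φ M hi (h j)

theorem canonicalHeightVec_matAct_le (hi : Function.Injective i) {m n : ℕ}
    (B : Matrix (Fin m) (Fin n) Fq[X]) :
    ∃ D : ℝ, 0 ≤ D ∧ ∀ x : Fin n → L,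
      canonicalHeightVec φ M (φ.matAct B x) ≤ D * canonicalHeightVec φ M x := by
  refine ⟨∑ j, ∑ k, ((φ.toFun (B j k)).natDegree : ℝ), by positivity, fun x => ?_⟩
  rw [canonicalHeightVec, Finset.sum_mul]
  refine Finset.sum_le_sum fun j _ => ?_
  rw [Finset.sum_mul]
  refine (canonicalHeight_sum_le φ M hi _ _).trans (Finset.sum_le_sum fun k _ => ?_)
  refine (canonicalHeight_act_le φ M _ _).trans (mul_le_mul_of_nonneg_left ?_ (by positivity))
  exact Finset.single_le_sum (f := fun k => canonicalHeight φ M (x k))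
    (fun k _ => canonicalHeight_nonneg φ M (x k)) (Finset.mem_univ k)

end CanonicalHeight
/-! ### Polynomials vanishing on an equidistributed sequence -/

section Integral

variable {σ K S : Type*} [Field K] [Field S] [Algebra K S] [Algebra.IsAlgebraic K S]

theorem isIntegralElem_map (P : MvPolynomial σ S) :
    (MvPolynomial.map (σ := σ) (algebraMap K S)).IsIntegralElem P := by
  induction P using MvPolynomial.induction_on with
  | C a =>
    obtain ⟨p, hp, hpa⟩ := Algebra.IsIntegral.isIntegral (R := K) a
    refine ⟨p.map MvPolynomial.C, hp.map _, ?_⟩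
    have : (MvPolynomial.map (σ := σ) (algebraMap K S)).comp MvPolynomial.C
        = MvPolynomial.C.comp (algebraMap K S) := by ext x; simp
    rw [eval₂_map, this, ← hom_eval₂, hpa, map_zero]
  | add P Q hP hQ => exact hP.add _ hQ
  | mul_X P j hP =>
    refine hP.mul _ ?_
    rw [← MvPolynomial.map_X (algebraMap K S)]
    exact RingHom.isIntegralElem_map _

/-- In an integral extension of domains, the nonzero ideal (P) contracts to a nonzero ideal. -/
theorem exists_dvd_map {P : MvPolynomial σ S} (hP : P ≠ 0) :
    ∃ Q : MvPolynomial σ K, Q ≠ 0 ∧ P ∣ MvPolynomial.map (algebraMap K S) Q := by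
  let _ : Algebra (MvPolynomial σ K) (MvPolynomial σ S) :=
    (MvPolynomial.map (algebraMap K S)).toAlgebra
  have h := Ideal.comap_ne_bot_of_integral_mem (R := MvPolynomial σ K) hP
    (Ideal.mem_span_singleton_self P) (isIntegralElem_map P)
  obtain ⟨Q, hQ, hQ0⟩ := Submodule.exists_mem_ne_zero_of_ne_bot h
  exact ⟨Q, hQ0, Ideal.mem_span_singleton.1 hQ⟩

end Integral

/-! ### Integration against the orbit measures and ν^(g) -/

section Measure

open MeasureTheory

variable {Fq : Type*} [Field Fq] [Fintype Fq] {K : Type*} [Field K] [Algebra Fq K]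
  {i : Fq[X] →ₐ[Fq] K} (φ : DrinfeldModule i) (w : InftyPlace i)

/-- Ensures that the product σ-algebra on T^g is the Borel one, so that continuous maps on T^g are
measurable. -/
instance : SecondCountableTopology (torsionClosure φ w) :=
  EMetric.secondCountable_of_sigmaCompact _

instance : (nu φ w).IsAddHaarMeasure := by
  unfold nu; infer_instance

/-- A continuous bounded nonnegative function whose integral against `ν^(g)` is zero vanishes on
`T^g`. -/
theorem eq_zero_of_integral_nuPow {g : ℕ} (f : BoundedContinuousFunction (Fin g → w.Cinf) ℝ)
    (h0 : ∀ z, 0 ≤ f z) (hf : ∫ z, f z ∂(nuPow φ w g) = 0) (z : Fin g → torsionClosure φ w) :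
    f (fun j => (z j : w.Cinf)) = 0 := by
  have hcont : Continuous fun (z : Fin g → torsionClosure φ w) (j : Fin g) => (z j : w.Cinf) := by
    fun_prop
  rw [nuPow, integral_map hcont.measurable.aemeasurable
    f.continuous.aestronglyMeasurable] at hf
  have hc : Continuous fun z : Fin g → torsionClosure φ w => f fun j => (z j : w.Cinf) :=
    f.continuous.comp hcont
  have hint : Integrable (fun z : Fin g → torsionClosure φ w => f fun j => (z j : w.Cinf))
      (Measure.pi fun _ : Fin g => nu φ w) :=
    hc.integrable_of_hasCompactSupport (HasCompactSupport.of_compactSpace _)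
  rw [integral_eq_zero_iff_of_nonneg (fun z => h0 _) hint] at hf
  -- The product of Haar measures charges every nonempty open set, so a continuous function that is
  -- almost everywhere 0 is 0.
  exact congrFun ((Continuous.ae_eq_iff_eq _ hc continuous_zero).1 hf) z

theorem integral_diracOrbit_eq_zero {g : ℕ} (f : BoundedContinuousFunction (Fin g → w.Cinf) ℝ)
    (x : Fin g → w.Ksep) (hf : ∀ y ∈ galOrbit x, f (toCinfVec y) = 0) :
    ∫ z, f z ∂(diracOrbit x) = 0 := by
  refine integral_eq_zero_of_ae ?_
  have hm : MeasurableSet {z | f z = 0} := (isClosed_eq f.continuous continuous_zero).measurableSet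
  refine Measure.ae_smul_measure ?_ _
  refine (Measure.ae_sum_iff' hm).2 fun y => ?_
  exact (ae_dirac_iff hm).2 (hf y.1 y.2)

theorem eq_zero_of_weaklyConverges (hi : Function.Injective i) {g : ℕ} (x : ℕ → Fin g → w.Ksep)
    (hconv : WeaklyConverges (fun k => diracOrbit (x k)) (nuPow φ w g))
    (P : MvPolynomial (Fin g) w.Ksep) (hP : ∀ k, MvPolynomial.aeval (toAlg (x k)) P = 0) :
    P = 0 := by
  by_contra hP0
  -- P need not vanish at the conjugates of x_k; its multiple Q has coefficients in K and does.
  obtain ⟨Q, hQ0, hPQ⟩ := exists_dvd_map (K := K) hP0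
  have hQx : ∀ k, ∀ y ∈ galOrbit (x k), MvPolynomial.aeval y Q = 0 := by
    rintro k _ ⟨σ, rfl⟩
    have h1 : MvPolynomial.aeval (x k) Q = 0 := by
      obtain ⟨R, hR⟩ := hPQ
      have h2 := congrArg (MvPolynomial.aeval (toAlg (x k))) hR
      rw [map_mul, hP, zero_mul] at h2
      apply (algebraMap w.Ksep w.Kalg).injective
      rw [map_zero, ← h2, MvPolynomial.aeval_map_algebraMap]
      exact (MvPolynomial.aeval_algebraMap_apply w.Kalg (x k) Q).symm
    have h3 := congrArg σ h1
    rw [map_zero] at h3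
    rw [← h3]
    exact (MvPolynomial.comp_aeval_apply (x k) σ.toAlgHom Q).symm
  let c : K →+* w.Cinf := w.toCinf.comp (algebraMap K w.Kalg)
  have hval : ∀ z : Fin g → w.Kalg, MvPolynomial.eval (fun j => w.toCinf (z j))
      (MvPolynomial.map c Q) = w.toCinf (MvPolynomial.aeval z Q) := fun z => by
    rw [MvPolynomial.eval_map, MvPolynomial.aeval_def, MvPolynomial.eval₂_comp_left]
    rfl
  -- Truncation at 1 makes |Q| a bounded test function with the same zeros.
  have hcont : Continuous fun z : Fin g → w.Cinf =>
      min 1 ‖MvPolynomial.eval z (MvPolynomial.map c Q)‖ :=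
    continuous_const.min (MvPolynomial.continuous_eval _).norm
  let f : BoundedContinuousFunction (Fin g → w.Cinf) ℝ :=
    BoundedContinuousFunction.ofNormedAddCommGroup _ hcont 1 fun z => by
      rw [Real.norm_of_nonneg (le_min zero_le_one (norm_nonneg _))]
      exact min_le_left _ _
  have hf : ∀ z, f z = min 1 ‖MvPolynomial.eval z (MvPolynomial.map c Q)‖ := fun z => rfl
  have hzero : ∫ z, f z ∂(nuPow φ w g) = 0 := by
    refine tendsto_nhds_unique (hconv f) ?_
    have : ∀ k, ∫ z, f z ∂(diracOrbit (x k)) = 0 := fun k => by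
      refine integral_diracOrbit_eq_zero w f (x k) fun y hy => ?_
      rw [hf]
      have h1 := hval fun j => (y j : w.Kalg)
      have h2 : MvPolynomial.aeval (fun j => (y j : w.Kalg)) Q = 0 := by
        have := MvPolynomial.aeval_algebraMap_apply w.Kalg y Q
        rw [hQx k y hy, map_zero] at this
        exact this
      rw [h2, map_zero] at h1
      change min 1 ‖MvPolynomial.eval (fun j => w.toCinf (y j : w.Kalg)) _‖ = 0
      rw [h1, norm_zero]; simp
    simp only [this, tendsto_const_nhds]
  have hclosed : IsAlgClosed w.Kalg := IsAlgClosure.isAlgClosed K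
  have hQz : MvPolynomial.map (algebraMap K w.Kalg) Q = 0 := by
    -- Torsion points lie in T, where the test function vanishes, and there are infinitely many of
    -- them.
    refine MvPolynomial.funext_set (fun _ => (φ.torsion w.Kalg : Set w.Kalg))
      (fun _ => φ.infinite_torsion hi) fun z hz => ?_
    rw [map_zero, MvPolynomial.eval_map]
    apply w.toCinf.injective
    rw [map_zero]
    refine (hval z).symm.trans ?_
    have h1 := eq_zero_of_integral_nuPow φ w f
      (fun z => le_min zero_le_one (norm_nonneg _)) hzero
      fun j => ⟨w.toCinf (z j), AddSubgroup.le_topologicalClosure _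
        (AddSubgroup.mem_map_of_mem _ (hz j trivial))⟩
    rw [hf] at h1
    rcases min_eq_iff.1 h1 with h | h
    · exact absurd h.1 one_ne_zero
    · exact norm_eq_zero.1 h.1
  exact hQ0 (MvPolynomial.map_injective _ (algebraMap K w.Kalg).injective
    (by rw [hQz, map_zero]))

end Measure
-- The Bogomolov statement from equidistribution
section Bogomolov

variable {Fq : Type*} [Field Fq] [Fintype Fq] {K : Type*} [Field K] [Algebra Fq K]
  {i : Fq[X] →ₐ[Fq] K} (φ : DrinfeldModule i)

section Density

variable {Ω : Type*} [Field Ω] [Algebra K Ω] {N : ℕ}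

theorem IsIrred.nonempty {V : Set (Fin N → Ω)} (hV : IsIrred K V) : V.Nonempty := by
  rw [Set.nonempty_iff_ne_empty]
  rintro rfl
  exact hV.ne_top MvPolynomial.vanishingIdeal_empty

theorem IsZariskiDenseIn.isIrred {S V : Set (Fin N → Ω)} (h : IsZariskiDenseIn K S V)
    (hV : IsIrred K V) : IsIrred K S := by
  have : MvPolynomial.vanishingIdeal (separableClosure K Ω) S
      = MvPolynomial.vanishingIdeal (separableClosure K Ω) V := by
    refine le_antisymm ?_ (MvPolynomial.vanishingIdeal_anti_mono h.1)
    rw [← h.2]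
    exact MvPolynomial.le_vanishingIdeal_zeroLocus _
  unfold IsIrred at hV ⊢
  rwa [this]

theorem toAlg_matAct {m n : ℕ} (C : Matrix (Fin m) (Fin n) Fq[X])
    (x : Fin n → separableClosure K Ω) : toAlg (φ.matAct C x) = φ.matAct C (toAlg x) :=
  funext fun j => φ.algebraMap_matAct (IsScalarTower.toAlgHom K (separableClosure K Ω) Ω) C x j

theorem toAlg_mem_torsion {x : Fin N → separableClosure K Ω} (h : IsTorsionPoint φ (toAlg x))
    (j : Fin N) : x j ∈ φ.torsion (separableClosure K Ω) := by
  obtain ⟨a, ha, h⟩ := h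
  refine ⟨a, ha, (algebraMap (separableClosure K Ω) Ω).injective ?_⟩
  rw [map_zero]
  exact (φ.algebraMap_act (IsScalarTower.toAlgHom K (separableClosure K Ω) Ω) a (x j)).trans (h j)

theorem exists_toAlg_eq {α : Fin N → Ω} (hα : ∀ j, α j ∈ separableClosure K Ω) :
    ∃ a : Fin N → separableClosure K Ω, toAlg a = α :=
  ⟨fun j => ⟨α j, hα j⟩, rfl⟩

end Density

variable (w : InftyPlace i) {ι : Type*} (M : ProductFormulaFamily K ι)

theorem exists_minimal_nat {p : ℕ → Prop} (h : ∃ n, p n) : ∃ n, p n ∧ ∀ m < n, ¬ p m := by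
  classical
  exact ⟨Nat.find h, Nat.find_spec h, fun _ hm => Nat.find_min h hm⟩

theorem isTorsionSubvariety_of_dense (hEnd : φ.EndEqA w.Ksep) {N : ℕ}
    (hconj : ∀ g : ℕ, 1 ≤ g → g ≤ N → SmallPointsConjecture φ w M g)
    {V : Set (Fin N → w.Kalg)} (hV : IsSubvariety K V) (hirr : IsIrred K V)
    (hdense : ∀ n : ℕ, 1 ≤ n → IsZariskiDenseIn K
      (toAlg '' {x : Fin N → w.Ksep | toAlg x ∈ V ∧ canonicalHeightVec φ M x < 1 / (n : ℝ)}) V) :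
    IsTorsionSubvariety φ V := by
  classical
  have hi := w.injective
  have hclosed : IsAlgClosed w.Kalg := IsAlgClosure.isAlgClosed K
  have hE : φ.AdditiveEndEqA w.Kalg := φ.additiveEndEqA hi hEnd
  -- The whole space, with g = N and the identity matrix, shows that some torsion subvariety
  -- contains V.
  have hex : ∃ g : ℕ, ∃ (α : Fin N → w.Kalg) (B : Matrix (Fin N) (Fin g) Fq[X])
      (C : Matrix (Fin g) (Fin N) Fq[X]), C * B = 1 ∧ IsTorsionPoint φ α ∧
        V ⊆ φ.affineImage α B :=
    ⟨N, 0, 1, 1, one_mul 1, ⟨1, one_ne_zero, fun j => φ.act_zero 1⟩, fun x _ =>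
      ⟨x, by simp [φ.matAct_one]⟩⟩
  obtain ⟨g, ⟨α, B, C, hCB, hα, hVB⟩, hmin⟩ := exists_minimal_nat hex
  have hαs := φ.isTorsionPoint_mem hi hα
  let G : (Fin g → w.Kalg) → Fin N → w.Kalg := fun y => α + φ.matAct B y
  let F : (Fin N → w.Kalg) → Fin g → w.Kalg := fun x => φ.matAct C (-α + x)
  have hGpoly : IsPolynomialMap K G :=
    DrinfeldModule.isPolynomialMap_add (φ.isPolynomialMap_matAct B) α hαs
  have hFpoly : IsPolynomialMap K F := DrinfeldModule.isPolynomialMap_comp_add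
    (φ.isPolynomialMap_matAct C) (-α) fun j => neg_mem (hαs j)
  have hFG : ∀ y, F (G y) = y := fun y => by
    simp only [F, G, neg_add_cancel_left]
    rw [← φ.matAct_mul, hCB, φ.matAct_one]
  have hGF : ∀ x ∈ V, G (F x) = x := fun x hx => by
    obtain ⟨y, rfl⟩ := hVB hx
    exact congrArg G (hFG y)
  have hsub : G ⁻¹' V = Set.univ → IsTorsionSubvariety φ V := fun huniv => by
    have : V = φ.affineImage α B := by
      refine Set.Subset.antisymm hVB ?_
      rintro _ ⟨y, rfl⟩
      exact huniv.symm.subset (Set.mem_univ y)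
    rw [this]
    exact φ.isTorsionSubvariety_affineImage hCB hα
  refine hsub ?_
  by_contra hne
  obtain ⟨P, hP0, hP⟩ := exists_polynomial_of_ne_univ (hV.preimage hGpoly) hne
  -- Equidistribution is only assumed for g ≥ 1. For g = 0 the space is a point, so the preimage of
  -- the nonempty V is everything.
  have hg1 : 1 ≤ g := by
    by_contra! h0
    obtain ⟨x, hx⟩ := hirr.nonempty
    have : IsEmpty (Fin g) := by
      rw [Nat.lt_one_iff.1 h0]; infer_instance
    refine hne (Set.eq_univ_of_forall fun y => ?_)
    rw [Subsingleton.elim y (F x), Set.mem_preimage, hGF x hx]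
    exact hx
  let 𝒯 : Set (Set (Fin g → w.Kalg)) := {T | IsTorsionSubvariety φ T ∧ T ≠ Set.univ}
  have hcount : 𝒯.Countable :=
    (φ.countable_isTorsionSubvariety hi hE).mono fun T hT => hT.1
  -- The enumeration f may also take values outside 𝒯, hence the conditions `f j ∈ 𝒯` below.
  obtain ⟨f, hf⟩ := Set.countable_iff_exists_subset_range.1 hcount
  -- Otherwise composing the two parametrizations would put V in a torsion subvariety with a smaller
  -- g.
  have hnot : ∀ T ∈ 𝒯, ¬ V ⊆ F ⁻¹' T := by
    rintro T ⟨hT, hTne⟩ hVT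
    obtain ⟨g', α', B', C', hCB', hα', rfl⟩ := φ.exists_eq_affineImage hi hE hT
    refine hmin g' (φ.lt_of_affineImage_ne_univ hCB' hTne)
      ⟨α + φ.matAct B α', B * B', C' * C, ?_,
        φ.isTorsionPoint_add hα (φ.isTorsionPoint_matAct B hα'), fun x hx => ?_⟩
    · rw [Matrix.mul_assoc, ← Matrix.mul_assoc C, hCB, Matrix.one_mul, hCB']
    · obtain ⟨y, hy⟩ := hVT hx
      refine ⟨y, ?_⟩
      rw [← hGF x hx, ← hy]
      simp only [G, φ.matAct_add, φ.matAct_mul, add_assoc]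
  -- If every point of height below 1/(k+1) lay in one of the finitely many listed preimages,
  -- irreducibility would put all these points, and by density V itself, into a single one.
  have hseq : ∀ k : ℕ, ∃ x : Fin N → w.Ksep, toAlg x ∈ V ∧
      canonicalHeightVec φ M x < 1 / ((k + 1 : ℕ) : ℝ) ∧
      ∀ j ≤ k, f j ∈ 𝒯 → F (toAlg x) ∉ f j := by
    intro k
    by_contra! hbad
    have hd := hdense (k + 1) (Nat.le_add_left 1 k)
    obtain ⟨j, hj, hsubj⟩ := (hd.isIrred hirr).subset_of_subset_biUnion
      ((Finset.range (k + 1)).filter fun j => f j ∈ 𝒯) (fun j => F ⁻¹' f j)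
      (fun j hj => (φ.isSubvariety_of_isTorsionSubvariety hi
        (Finset.mem_filter.1 hj).2.1).preimage hFpoly) (by
        rintro _ ⟨x, ⟨hxV, hxh⟩, rfl⟩
        obtain ⟨j, hjk, hjT, hxj⟩ := hbad x hxV hxh
        exact Set.mem_iUnion₂.2 ⟨j, Finset.mem_filter.2
          ⟨Finset.mem_range.2 (Nat.lt_succ_of_le hjk), hjT⟩, hxj⟩)
    have hjT := (Finset.mem_filter.1 hj).2
    refine hnot _ hjT ?_
    rw [← hd.2]
    exact zeroLocus_vanishingIdeal_subset
      ((φ.isSubvariety_of_isTorsionSubvariety hi hjT.1).preimage hFpoly) hsubj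
  choose x hxV hxh hxT using hseq
  obtain ⟨a, ha⟩ := exists_toAlg_eq hαs
  let y : ℕ → Fin g → w.Ksep := fun k => φ.matAct C (-a + x k)
  have hy : ∀ k, toAlg (y k) = F (toAlg (x k)) := fun k => by
    rw [toAlg_matAct]
    simp only [F, ← ha]
    rfl
  have hstrict : IsStrict φ fun k => toAlg (y k) := by
    intro T hT hTne
    obtain ⟨j, rfl⟩ := hf ⟨hT, hTne⟩
    refine (Set.finite_lt_nat j).subset fun k hk => ?_
    by_contra hjk
    refine hxT k j (not_lt.1 hjk) ⟨hT, hTne⟩ ?_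
    rw [← hy]
    exact hk
  obtain ⟨D, hD0, hD⟩ := canonicalHeightVec_matAct_le φ M (L := w.Ksep) hi C
  have ha0 : canonicalHeightVec φ M (-a) = 0 := canonicalHeightVec_eq_zero φ M hi fun j =>
    neg_mem (toAlg_mem_torsion φ (by rw [ha]; exact hα) j)
  have hheight : Tendsto (fun k => canonicalHeightVec φ M (y k)) atTop (𝓝 0) := by
    have hlim : Tendsto (fun k : ℕ => D * (1 / ((k : ℝ) + 1))) atTop (𝓝 0) := by
      simpa using tendsto_one_div_add_atTop_nhds_zero_nat.const_mul D
    refine squeeze_zero (fun k => canonicalHeightVec_nonneg φ M _) (fun k => ?_) hlim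
    refine (hD _).trans (mul_le_mul_of_nonneg_left ?_ hD0)
    have h1 := canonicalHeightVec_add_le φ M (-a) (x k)
    have h2 := hxh k
    push_cast at h2
    rw [ha0, zero_add] at h1
    exact h1.trans h2.le
  refine hP0 (eq_zero_of_weaklyConverges φ w hi y
    (hconj g hg1 (le_of_matrix_mul_eq_one hCB) hEnd y hstrict hheight) P fun k => ?_)
  refine hP _ ?_
  rw [Set.mem_preimage, hy, hGF _ (hxV k)]
  exact hxV k

end Bogomolov

/-! ### Finite torsion covers by Noetherian induction -/

section Cover

variable {Fq : Type*} [Field Fq] [Fintype Fq] {K : Type*} [Field K] [Algebra Fq K]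
  {i : Fq[X] →ₐ[Fq] K} (φ : DrinfeldModule i) (w : InftyPlace i) {ι : Type*}
  (M : ProductFormulaFamily K ι)

/-- A finite set of torsion subvarieties of `V` containing, up to inclusion, all torsion
subvarieties of `V` and all points of `V` of small height. -/
def IsTorsionCover {N : ℕ} (V : Set (Fin N → w.Kalg)) (F : Set (Set (Fin N → w.Kalg))) : Prop :=
  F.Finite ∧ (∀ T ∈ F, IsTorsionSubvariety φ T ∧ T ⊆ V) ∧
    (∀ T, IsTorsionSubvariety φ T → T ⊆ V → ∃ T' ∈ F, T ⊆ T') ∧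
    ∃ c : ℝ, 0 < c ∧ ∀ x : Fin N → w.Ksep, toAlg x ∈ V → canonicalHeightVec φ M x < c →
      ∃ T ∈ F, toAlg x ∈ T

theorem IsTorsionCover.union {N : ℕ} {V V₁ V₂ : Set (Fin N → w.Kalg)}
    {F₁ F₂ : Set (Set (Fin N → w.Kalg))} (h₁ : IsTorsionCover φ w M V₁ F₁)
    (h₂ : IsTorsionCover φ w M V₂ F₂) (hV₁ : V₁ ⊆ V) (hV₂ : V₂ ⊆ V) (hV : V ⊆ V₁ ∪ V₂)
    (hT : ∀ T, IsTorsionSubvariety φ T → T ⊆ V → T ⊆ V₁ ∨ T ⊆ V₂) :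
    IsTorsionCover φ w M V (F₁ ∪ F₂) := by
  obtain ⟨f₁, s₁, t₁, c₁, hc₁, k₁⟩ := h₁
  obtain ⟨f₂, s₂, t₂, c₂, hc₂, k₂⟩ := h₂
  refine ⟨f₁.union f₂, ?_, fun T h hTV => ?_, min c₁ c₂, lt_min hc₁ hc₂, fun x hx hlt => ?_⟩
  · rintro T (h | h)
    · exact ⟨(s₁ T h).1, (s₁ T h).2.trans hV₁⟩
    · exact ⟨(s₂ T h).1, (s₂ T h).2.trans hV₂⟩
  · rcases hT T h hTV with h' | h'
    · obtain ⟨T', hT', hle⟩ := t₁ T h h'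
      exact ⟨T', Or.inl hT', hle⟩
    · obtain ⟨T', hT', hle⟩ := t₂ T h h'
      exact ⟨T', Or.inr hT', hle⟩
  · rcases hV hx with h' | h'
    · obtain ⟨T', hT', hle⟩ := k₁ x h' (hlt.trans_le (min_le_left _ _))
      exact ⟨T', Or.inl hT', hle⟩
    · obtain ⟨T', hT', hle⟩ := k₂ x h' (hlt.trans_le (min_le_right _ _))
      exact ⟨T', Or.inr hT', hle⟩

/-- Induction on vanishing ideals: V is replaced by strictly smaller closed subsets that still
contain all its torsion subvarieties and small points. -/
theorem exists_isTorsionCover (hEnd : φ.EndEqA w.Ksep) {N : ℕ}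
    (hB : BogomolovConjecture φ w M N) (V : Set (Fin N → w.Kalg)) (hV : IsSubvariety K V) :
    ∃ F, IsTorsionCover φ w M V F := by
  have hi := w.injective
  have hclosed : IsAlgClosed w.Kalg := IsAlgClosure.isAlgClosed K
  have hE : φ.AdditiveEndEqA w.Kalg := φ.additiveEndEqA hi hEnd
  induction hJ : MvPolynomial.vanishingIdeal w.Ksep V using WellFoundedGT.induction
    generalizing V with
  | ind J ih =>
    subst hJ
    have hVV := hV.zeroLocus_vanishingIdeal
    have hlt : ∀ V', IsSubvariety K V' → V' ⊆ V → V' ≠ V →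
        MvPolynomial.vanishingIdeal w.Ksep V < MvPolynomial.vanishingIdeal w.Ksep V' := by
      intro V' hV' hsub hne
      refine lt_of_le_of_ne (MvPolynomial.vanishingIdeal_anti_mono hsub) fun h => hne ?_
      rw [← hV'.zeroLocus_vanishingIdeal, ← hVV]
      exact congrArg _ h.symm
    by_cases htop : MvPolynomial.vanishingIdeal w.Ksep V = ⊤
    · have hempty : V = ∅ := by
        rw [← hVV]
        exact (congrArg _ htop).trans MvPolynomial.zeroLocus_top
      subst hempty
      exact ⟨∅, Set.finite_empty, by simp, fun T hT hTV => absurd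
        (φ.isIrred_of_isTorsionSubvariety hi hT).nonempty
        (Set.not_nonempty_iff_eq_empty.2 (Set.subset_empty_iff.1 hTV)), 1, one_pos,
        fun x hx => absurd hx (Set.notMem_empty _)⟩
    by_cases hirr : IsIrred K V
    · by_cases hdense : ∀ n : ℕ, 1 ≤ n → IsZariskiDenseIn K (toAlg ''
          {x : Fin N → w.Ksep | toAlg x ∈ V ∧ canonicalHeightVec φ M x < 1 / (n : ℝ)}) V
      · have hVt := hB hEnd V hV hirr hdense
        exact ⟨{V}, Set.finite_singleton V, by simpa using hVt, fun T _ hTV => ⟨V, rfl, hTV⟩,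
          1, one_pos, fun x hx _ => ⟨V, rfl, hx⟩⟩
      · push Not at hdense
        obtain ⟨n, hn, hnd⟩ := hdense
        set S : Set (Fin N → w.Kalg) := toAlg ''
          {x : Fin N → w.Ksep | toAlg x ∈ V ∧ canonicalHeightVec φ M x < 1 / (n : ℝ)} with hS
        have hSV : S ⊆ V := by
          rintro _ ⟨x, hx, rfl⟩
          exact hx.1
        have hnpos : (0 : ℝ) < 1 / n := by
          have : (0 : ℝ) < n := by exact_mod_cast hn
          positivity
        -- The closure of the points of height below 1/n, a proper subset of V by the choice of n.
        let V' := MvPolynomial.zeroLocus w.Kalg (MvPolynomial.vanishingIdeal w.Ksep S)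
        have hV' : IsSubvariety K V' := ⟨_, rfl⟩
        have hV'V : V' ⊆ V := zeroLocus_vanishingIdeal_subset hV hSV
        obtain ⟨F, hF, hFV, hFT, c, hc, hFc⟩ :=
          ih _ (hlt V' hV' hV'V fun h => hnd ⟨hSV, h⟩) V' hV' rfl
        have hSV' : S ⊆ V' := MvPolynomial.zeroLocus_vanishingIdeal_le S
        refine ⟨F, hF, fun T hT => ⟨(hFV T hT).1, (hFV T hT).2.trans hV'V⟩,
          fun T hT hTV => hFT T hT ?_, min c (1 / n), lt_min hc hnpos, fun x hx hxlt =>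
          hFc x (hSV' ⟨x, ⟨hx, hxlt.trans_le (min_le_right _ _)⟩, rfl⟩)
            (hxlt.trans_le (min_le_left _ _))⟩
        -- Torsion points have coordinates in K^sep and height 0, so those of T lie in S; being
        -- dense in T, they force T ⊆ V'.
        refine φ.subset_of_torsionPoints_subset hi hE hT hV' fun z hz hzt => hSV' ?_
        obtain ⟨x, rfl⟩ := exists_toAlg_eq (φ.isTorsionPoint_mem hi hzt)
        refine ⟨x, ⟨hTV hz, ?_⟩, rfl⟩
        rw [canonicalHeightVec_eq_zero φ M hi (toAlg_mem_torsion φ hzt)]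
        exact hnpos
    · obtain ⟨f, f', hff', hf, hf'⟩ : ∃ f f' : MvPolynomial (Fin N) w.Ksep,
          f * f' ∈ MvPolynomial.vanishingIdeal w.Ksep V ∧
          f ∉ MvPolynomial.vanishingIdeal w.Ksep V ∧
          f' ∉ MvPolynomial.vanishingIdeal w.Ksep V := by
        by_contra! h
        exact hirr ⟨htop, fun {a b} hab => or_iff_not_imp_left.2 fun ha => by
          by_contra hb
          exact hb (h a b hab ha)⟩
      let Z : MvPolynomial (Fin N) w.Ksep → Set (Fin N → w.Kalg) := fun f =>
        {x | x ∈ V ∧ MvPolynomial.aeval x f = 0}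
      have hZ : ∀ f, IsSubvariety K (Z f) := by
        intro f
        refine ⟨Ideal.span (insert f (MvPolynomial.vanishingIdeal w.Ksep V)), ?_⟩
        ext x
        rw [MvPolynomial.zeroLocus_span]
        simp only [Z, Set.mem_ofPred_eq, Set.forall_mem_insert]
        constructor
        · rintro ⟨hx, hfx⟩
          exact ⟨hfx, fun p hp => hp x hx⟩
        · rintro ⟨hfx, hx⟩
          exact ⟨hVV.subset hx, hfx⟩
      have hZV : ∀ f, Z f ⊆ V := fun f x hx => hx.1
      have hZne : ∀ f, f ∉ MvPolynomial.vanishingIdeal w.Ksep V → Z f ≠ V :=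
        fun f hf h => hf fun x hx => (h.symm.subset hx).2
      obtain ⟨F, hF⟩ := ih _ (hlt _ (hZ f) (hZV f) (hZne f hf)) (Z f) (hZ f) rfl
      obtain ⟨F', hF'⟩ := ih _ (hlt _ (hZ f') (hZV f') (hZne f' hf')) (Z f') (hZ f') rfl
      refine ⟨F ∪ F', hF.union φ w M hF' (hZV f) (hZV f') (fun x hx => ?_) fun T hT hTV => ?_⟩
      · have := hff' x hx
        rw [map_mul, mul_eq_zero] at this
        exact this.imp (fun h => ⟨hx, h⟩) fun h => ⟨hx, h⟩
      -- An irreducible torsion subvariety of V lies in one of the two pieces.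
      · have hTirr := φ.isIrred_of_isTorsionSubvariety hi hT
        have hmem : f * f' ∈ MvPolynomial.vanishingIdeal w.Ksep T :=
          MvPolynomial.vanishingIdeal_anti_mono hTV hff'
        exact (hTirr.mem_or_mem hmem).imp (fun h x hx => ⟨hTV hx, h x hx⟩)
          fun h x hx => ⟨hTV hx, h x hx⟩

end Cover
end DrinfeldBogomolov

open DrinfeldBogomolov in
/-- Let `φ` be a Drinfeld module of generic characteristic with `End(φ) = A`, and assume the
small-points equidistribution conjecture for `φ` on `𝔾_a^g` for all `1 ≤ g ≤ N`. If `V` is a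
`K^sep`-subvariety of an algebraic `φ`-submodule `Y` of `𝔾_a^N`, then `V` has finitely many maximal
torsion subvarieties, and if their union `Z` is not `V`, then `ĥ` is bounded below by a positive
constant on `(V \ Z)(K^sep)`. Moreover the Bogomolov conjecture holds for `φ` and `𝔾_a^N`. -/
theorem mainTheorem3 {Fq : Type*} [Field Fq] [Fintype Fq] {K : Type*} [Field K] [Algebra Fq K]
    (i : Fq[X] →ₐ[Fq] K) (hi : Function.Injective i) (φ : DrinfeldModule i) (w : InftyPlace i)
    {ι : Type*} (M : ProductFormulaFamily K ι) (hEnd : φ.EndEqA w.Ksep) (N : ℕ)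
    (hconj : ∀ g : ℕ, 1 ≤ g → g ≤ N → SmallPointsConjecture φ w M g) :
    (∀ Y V : Set (Fin N → w.Kalg), IsAlgebraicSubmodule φ Y → IsSubvariety K V → V ⊆ Y →
      (maximalTorsionSubvarieties φ V).Finite ∧
      (⋃₀ maximalTorsionSubvarieties φ V ≠ V →
        ∃ c : ℝ, 0 < c ∧ ∀ x : Fin N → w.Ksep,
          toAlg x ∈ V \ ⋃₀ maximalTorsionSubvarieties φ V → c ≤ canonicalHeightVec φ M x)) ∧
    BogomolovConjecture φ w M N := by
  have hB : BogomolovConjecture φ w M N := fun hE V hV hirr hd =>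
    isTorsionSubvariety_of_dense φ w M hE hconj hV hirr hd
  refine ⟨fun Y V _ hV _ => ?_, hB⟩
  obtain ⟨F, hfin, hFV, hFT, c, hc, hFc⟩ := exists_isTorsionCover φ w M hEnd hB V hV
  refine ⟨hfin.subset fun W hW => ?_, fun _ => ⟨c, hc, fun x hx => ?_⟩⟩
  -- W lies in some member of the cover, and maximality forces equality.
  · replace hW : Maximal (fun W => IsTorsionSubvariety φ W ∧ W ⊆ V) W := hW
    obtain ⟨T, hT, hWT⟩ := hFT W hW.prop.1 hW.prop.2
    rwa [hW.eq_of_le (hFV T hT) hWT]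
  · by_contra! hlt
    obtain ⟨T, hT, hxT⟩ := hFc x hx.1 hlt
    -- A member T' that is maximal within the finite cover is a maximal torsion subvariety of V,
    -- since every torsion subvariety of V lies in a member of the cover.
    obtain ⟨T', hTT', hT'⟩ := hfin.exists_le_maximal hT
    refine hx.2 ⟨T', ⟨hFV T' hT'.prop, fun T₁ hT₁ hle => ?_⟩, hTT' hxT⟩
    obtain ⟨T₂, hT₂, hle'⟩ := hFT T₁ hT₁.1 hT₁.2
    exact hle'.trans (hT'.le_of_ge hT₂ (hle.trans hle'))
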